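/- **Theorem (excess risk bound, bounded excess risk case).** *Setting.* Let $P$ be a probability measure on a measurable space $\mathcal Z$, let the model $\mathcal F$ be a measurable space, and let $(f,z)\mapsto \ell_f(z)\in(-\infty,\infty]$ be a jointly measurable loss such that $\mathbf E_{Z\sim P}[\ell_f(Z)^-]<\infty$ for every $f\in\mathcal F$ and $\mathbf E_{Z\sim P}[\ell_f(Z)]<\infty$ for some $f\in\mathcal F$. (Here $x^-=\max\{-x,0\}$, and expectations take values in $[-\infty,\infty]$.) Let $\Delta(\mathcal F)$ be the set of probability measures $Q$ on $\mathcal F$ with $\mathbf E_{f\sim Q}[\ell_f(z)^-]<\infty$ for all $z\in\mathcal Z$. A learning algorithm $\Pi$ assigns, for every $n\ge 0$, to each sample $z^n=(z_1,\dots,z_n)\in\mathcal Z^n$ a distribution $\Pi\mid z^n\in\Delta(\mathcal F)$, measurably in $z^n$, such that $\mathrm{KL}(\Pi\mid z^n\,\|\,\Pi_0)$ is also measurable in $z^n$. Here $\Pi_0$ is the output on the empty sample. Let $Z_1,\dots,Z_n$ be i.i.d. with law $P$, write $Z_1^n=(Z_1,\dots,Z_n)$ and $\Pi_n=\Pi\mid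 Z_1^n$. For a comparator $f^*\in\mathcal F$ put $L_f=\ell_f-\ell_{f^*}$ and, for $n\ge 1$, $\eta>0$, $$\mathrm{IC}_{n,\eta}(f^*\,\|\,\Pi)=\mathbf E_{f\sim\Pi_n}\Big[\frac1n\sum_{i=1}^n L_f(Z_i)\Big]+\frac{\mathrm{KL}(\Pi_n\,\|\,\Pi_0)}{\eta n}.$$ For random variables $U,V$ and $\eta>0$, $U\trianglelefteq_\eta V$ means $\mathbf E[e^{\eta(U-V)}]\le 1$. *Conditions.* The $(u,c)$-witness condition with comparator $f^*$ (for $u>0$, $c\in(0,1]$) is: $\mathbf E[L_f\,\mathbf 1\{L_f\le u\}]\ge c\,\mathbf E[L_f]$ for all $f\in\mathcal F$. Let $v:[0,\infty)\to[0,\infty)$ be bounded and non-decreasing with $v(\epsilon)>0$ for $\epsilon>0$. The $v$-central condition is: for every $\epsilon\ge 0$ with $v(\epsilon)>0$ there is $f^*\in\mathcal F$ with $\ell_{f^*}-\ell_f\trianglelefteq_{v(\epsilon)}\epsilon$ for all $f\in\mathcal F$; such an $f^*$ is said to witness the condition at level $\epsilon$. The $v$-PPC condition with comparator $f^*$ is: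 for every $\epsilon\ge 0$ with $\eta=v(\epsilon)>0$, $$\mathbf E_{Z\sim P}[\ell_{f^*}]-\inf_{Q\in\Delta(\mathcal F)}\mathbf E_{Z\sim P}\Big[-\frac1\eta\log\mathbf E_{f\sim Q}\big[e^{-\eta\ell_f(Z)}\big]\Big]\le\epsilon .$$ *Statement.* Let $\Pi$ be any learning algorithm, let $f^*\in\mathcal F$, and assume the $(u,c)$-witness condition with comparator $f^*$. For $\epsilon\ge 0$ and $0<\eta<v(\epsilon)/2$ put $$c'_{2u}=\frac1c\cdot\frac{2\eta u+1}{1-2\eta/v(\epsilon)} .$$ 1. If the $v$-central condition holds, then for every $\epsilon\ge0$ at which $f^*$ witnesses it, every $0<\eta<v(\epsilon)/2$ and every $n\ge1$, $$\mathbf E_{f\sim\Pi_n}\big[\mathbf E[L_f]\big]\ \trianglelefteq_{\frac{\eta n}{2c'_{2u}}}\ c'_{2u}\big(\mathrm{IC}_{n,\eta}(f^*\,\|\,\Pi)+\epsilon\big).$$ 2. If the $v$-PPC condition with comparator $f^*$ holds, then for every $\epsilon\ge0$, every $0<\eta<v(\epsilon)/2$ and every $n\ge1$, $$\mathbf E_{Z_1^n}\Big[\mathbf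 E_{f\sim\Pi_n}\big[\mathbf E[L_f]\big]\Big]\ \le\ c'_{2u}\Big(\mathbf E_{Z_1^n}\big[\mathrm{IC}_{n,\eta}(f^*\,\|\,\Pi)\big]+\epsilon\Big).$$ -/

import Mathlib

open MeasureTheory ProbabilityTheory

namespace ExcessRisk

/-- Expectation of an extended-real random variable: `E[U⁺] - E[U⁻]`, allowed to be `±∞`.
In the undefined case `E[U⁺] = E[U⁻] = ∞` the value is `⊥`. -/
noncomputable def expect {Ω : Type*} [MeasurableSpace Ω] (μ : Measure Ω) (U : Ω → EReal) : EReal :=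
  ((∫⁻ ω, (U ω).toENNReal ∂μ : ENNReal) : EReal) - ((∫⁻ ω, (-U ω).toENNReal ∂μ : ENNReal) : EReal)

/-- Exponential stochastic inequality at rate `η`: `E[exp (η (U - V))] ≤ 1`. -/
def ESI {Ω : Type*} [MeasurableSpace Ω] (μ : Measure Ω) (η : ℝ) (U V : Ω → EReal) : Prop :=
  ∫⁻ ω, EReal.exp ((η : EReal) * (U ω - V ω)) ∂μ ≤ 1

/-- A learning problem `(P, ℓ, F)`.  Losses take values in `(-∞, ∞]`, the negative part of each
loss is `P`-integrable, and some predictor has risk `< ∞`. -/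
structure LearningProblem (Z F : Type*) [MeasurableSpace Z] [MeasurableSpace F] where
  P : Measure Z
  isProb : IsProbabilityMeasure P
  loss : F → Z → EReal
  measurable_loss : Measurable (Function.uncurry loss)
  loss_ne_bot : ∀ f z, loss f z ≠ ⊥
  negPart_lt_top : ∀ f, ∫⁻ z, (-loss f z).toENNReal ∂P < ⊤
  nontrivial : ∃ f, expect P (loss f) < ⊤

instance {Z F : Type*} [MeasurableSpace Z] [MeasurableSpace F] (L : LearningProblem Z F) :
    IsProbabilityMeasure L.P := L.isProb

namespace LearningProblem

variable {Z F : Type*} [MeasurableSpace Z] [MeasurableSpace F]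

/-- The admissible distributions `Q` on `F`: probability measures under which the negative part
of the loss at every outcome `z` is integrable. -/
def distributions (L : LearningProblem Z F) : Set (Measure F) :=
  {Q | IsProbabilityMeasure Q ∧ ∀ z, ∫⁻ f, (-L.loss f z).toENNReal ∂Q < ⊤}

/-- The excess loss `ℓ_f - ℓ_{f*}` relative to the comparator `f*`. -/
noncomputable def excessLoss (L : LearningProblem Z F) (fstar f : F) (z : Z) : EReal :=
  L.loss f z - L.loss fstar z

/-- The excess risk `E[ℓ_f - ℓ_{f*}]`. -/
noncomputable def excessRisk (L : LearningProblem Z F) (fstar f : F) : EReal :=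
  expect L.P (L.excessLoss fstar f)

open Classical in
/-- The `(u, c)`-witness condition with comparator `f*`. -/
def Witness (L : LearningProblem Z F) (fstar : F) (u c : ℝ) : Prop :=
  ∀ f, (c : EReal) * L.excessRisk fstar f ≤
    expect L.P (fun z => if L.excessLoss fstar f z ≤ (u : EReal) then L.excessLoss fstar f z else 0)

/-- The comparator `f*` witnesses the `η`-central condition up to `ε`. -/
def CentralUpTo (L : LearningProblem Z F) (fstar : F) (η ε : ℝ) : Prop :=
  ∀ f, ESI L.P η (fun z => L.loss fstar z - L.loss f z) (fun _ => (ε : EReal))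

/-- The `v`-central condition (at levels with `v ε = 0` it asks for nothing). -/
def VCentral (L : LearningProblem Z F) (v : NNReal → NNReal) : Prop :=
  ∀ ε : NNReal, 0 < v ε → ∃ fstar, L.CentralUpTo fstar (v ε) ε

/-- The mix loss `-(1/η) log E_{f ∼ Q}[exp (-η ℓ_f(z))]`. -/
noncomputable def mixLoss (L : LearningProblem Z F) (η : ℝ) (Q : Measure F) (z : Z) : EReal :=
  ((-(1 / η) : ℝ) : EReal) * ENNReal.log (∫⁻ f, EReal.exp (((-η : ℝ) : EReal) * L.loss f z) ∂Q)

/-- The `v`-PPC condition with comparator `f*` (at levels with `v ε = 0` it asks for nothing). -/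
def VPPC (L : LearningProblem Z F) (fstar : F) (v : NNReal → NNReal) : Prop :=
  ∀ ε : NNReal, 0 < v ε →
    expect L.P (L.loss fstar) - (⨅ Q ∈ L.distributions, expect L.P (L.mixLoss (v ε) Q))
      ≤ ((ε : ℝ) : EReal)

end LearningProblem

/-- The functions `v` used in the `v`-central and `v`-PPC conditions. -/
structure IsEasinessFunction (v : NNReal → NNReal) : Prop where
  mono : Monotone v
  bdd : BddAbove (Set.range v)
  pos : ∀ ε, 0 < ε → 0 < v ε

/-- A (randomized, proper) learning algorithm: to each sample `z₁, …, zₙ`, including the empty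
one, it assigns an admissible distribution on `F`, measurably in the sample.  The Kullback-Leibler
term of the information complexity is required to be a random variable; this is automatic, e.g.,
if the `σ`-algebra of `F` is countably generated. -/
structure LearningAlgorithm {Z F : Type*} [MeasurableSpace Z] [MeasurableSpace F]
    (L : LearningProblem Z F) where
  post : (n : ℕ) → Kernel (Fin n → Z) F
  post_mem : ∀ n zs, post n zs ∈ L.distributions
  measurable_klDiv : ∀ n,
    Measurable fun zs => InformationTheory.klDiv (post n zs) (post 0 (Fin.elim0 ·))

namespace LearningAlgorithm

variable {Z F : Type*} [MeasurableSpace Z] [MeasurableSpace F] {L : LearningProblem Z F}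

/-- The output of the algorithm on the empty sample. -/
noncomputable def prior (A : LearningAlgorithm L) : Measure F := A.post 0 (Fin.elim0 ·)

/-- The information complexity
`E_{f ∼ Πₙ}[(1/n) ∑ᵢ (ℓ_f(zᵢ) - ℓ_{f*}(zᵢ))] + KL(Πₙ ‖ Π₀) / (η n)`. -/
noncomputable def infoComplexity (A : LearningAlgorithm L) (fstar : F) (n : ℕ) (η : ℝ)
    (zs : Fin n → Z) : EReal :=
  expect (A.post n zs) (fun f => ((1 / n : ℝ) : EReal) * ∑ i, L.excessLoss fstar f (zs i)) +
    (InformationTheory.klDiv (A.post n zs) A.prior : EReal) / ((η * n : ℝ) : EReal)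

/-- The posterior-expected excess risk `E_{f ∼ Πₙ}[E[ℓ_f - ℓ_{f*}]]`. -/
noncomputable def posteriorRisk (A : LearningAlgorithm L) (fstar : F) (n : ℕ)
    (zs : Fin n → Z) : EReal :=
  expect (A.post n zs) (L.excessRisk fstar)

end LearningAlgorithm

/-- The constant `c'_{2u} = (1/c) (2ηu + 1) / (1 - 2η/v)`. -/
noncomputable def cPrime (u c η v : ℝ) : ℝ := (1 / c) * ((2 * η * u + 1) / (1 - 2 * η / v))

end ExcessRisk

/-!
Both bounds are instances of one argument, organized around an *offset*: an integrable function
`D` with `E[D] ≤ ε`, `E[e^{-κD}] ≤ 1` and `E[e^{-κ(L_f + D)}] ≤ 1` for all `f`, where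
`L_f = ℓ_f - ℓ_{f*}` and `κ = v(ε)`.  It says that the pseudo-loss `ℓ_{f*} - D` satisfies the
`κ`-central condition without slack.

*Existence.*  Under the central condition up to `ε` the constant `D = ε` is an offset
(`CentralUpTo.isOffset`).  Under the PPC condition `D` is the regret of `f*` against the reversed
information projection of `P` on the mixture likelihoods `E_{f ∼ Q}[e^{-κℓ_f}]`.  Its existence is
`exists_reversed_projection`: near-maximizers of the expected logarithm over a convex set have
converging logarithms, by strict concavity, and the e-variable property `E[r / G] ≤ 1` and the
bound on `E[log G]` follow from Fatou's lemma applied to `log (1 + τ r / q)`.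

*Transfer.*  With `h_κ(x) = (1 - e^{-κx})/κ` and `C (1 - η/κ) ≥ 1 + 2ηu` one has, for all real `m`
and `d`,
`(m - d) 1{m - d ≤ u} ≤ C h_η(m) - (C - 1) h_κ(m) - h_κ(d)` (`truncation_le_expUtil`).
With `m = L_f + D` and `d = D` the expectations of `h_κ(m)` and `h_κ(d)` are nonnegative, so the
witness condition gives `c E[L_f] / C ≤ E[h_η(L_f + D)]`.  In particular all excess risks are real
and uniformly bounded, and `E[e^{-η(L_f + D)}] ≤ e^{-η c E[L_f] / C}` (`exists_excessRisk_eq`).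

*Generalization.*  By the previous bound, Tonelli's theorem and the Donsker–Varadhan inequality,
`E exp (ηn (E_{f ∼ Πₙ}[E[L_f]] c / C - (1/n) ∑ D(Zᵢ) - IC)) ≤ 1`
(`lintegral_exp_sub_infoComplexity_le`).  For `D = ε` this is stronger than the first bound by a
factor two in the rate; for general `D`, Jensen's inequality gives the second.
-/

namespace ExcessRisk

/-! ### The pointwise inequality -/

/-- The exponential utility `(1 - e^{-κx})/κ`, for `κ > 0` a concave minorant of `x` that
agrees with it to first order at `0`. -/
noncomputable def expUtil (κ x : ℝ) : ℝ := (1 - Real.exp (-κ * x)) / κ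

lemma expUtil_le_self {κ : ℝ} (hκ : 0 < κ) (x : ℝ) : expUtil κ x ≤ x := by
  rw [expUtil, div_le_iff₀ hκ]
  have := Real.add_one_le_exp (-κ * x)
  linarith

lemma expUtil_le_inv {κ : ℝ} (hκ : 0 < κ) (x : ℝ) : expUtil κ x ≤ 1 / κ := by
  rw [expUtil]
  gcongr
  have := Real.exp_pos (-κ * x)
  linarith

lemma expUtil_mono {κ : ℝ} (hκ : 0 < κ) {x y : ℝ} (h : x ≤ y) : expUtil κ x ≤ expUtil κ y := by
  unfold expUtil
  gcongr ?_ / _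
  have : Real.exp (-κ * y) ≤ Real.exp (-κ * x) := Real.exp_le_exp.2 (by nlinarith)
  linarith

lemma expUtil_add (κ x y : ℝ) :
    expUtil κ (x + y) = expUtil κ x + Real.exp (-κ * x) * expUtil κ y := by
  unfold expUtil
  rw [mul_add, Real.exp_add]
  ring

lemma mul_exp_le_expUtil {κ : ℝ} (hκ : 0 < κ) (x : ℝ) :
    x * Real.exp (-κ * x) ≤ expUtil κ x := by
  rw [expUtil, le_div_iff₀ hκ]
  have h1 := Real.add_one_le_exp (κ * x)
  have h2 : Real.exp (κ * x) * Real.exp (-κ * x) = 1 := by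
    rw [← Real.exp_add]; simp
  have h3 := mul_le_mul_of_nonneg_right h1 (Real.exp_pos (-κ * x)).le
  nlinarith

lemma exp_mul_le_convex_comb {ρ : ℝ} (h0 : 0 ≤ ρ) (h1 : ρ ≤ 1) (x : ℝ) :
    Real.exp (ρ * x) ≤ (1 - ρ) + ρ * Real.exp x := by
  have := convexOn_exp.2 (Set.mem_univ (0 : ℝ)) (Set.mem_univ x) (sub_nonneg.2 h1) h0 (by ring)
  simpa using this

/-- The trapezoidal rule overestimates the integral of the convex function `e^{-κt}`. -/
lemma expUtil_le_trapezoid {κ : ℝ} (hκ : 0 < κ) {x : ℝ} (hx : 0 ≤ x) :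
    expUtil κ x ≤ x * (1 + Real.exp (-κ * x)) / 2 := by
  have key : ∀ y : ℝ, 0 ≤ y → 0 ≤ y * (1 + Real.exp (-y)) / 2 - (1 - Real.exp (-y)) := by
    intro y hy
    have hm : MonotoneOn (fun y : ℝ => y * (1 + Real.exp (-y)) / 2 - (1 - Real.exp (-y)))
        (Set.Ici 0) := by
      have hd : ∀ y : ℝ, HasDerivAt
          (fun y : ℝ => y * (1 + Real.exp (-y)) / 2 - (1 - Real.exp (-y)))
          ((1 - Real.exp (-y) - y * Real.exp (-y)) / 2) y := by
        intro y
        have h1 : HasDerivAt (fun y : ℝ => Real.exp (-y)) (-Real.exp (-y)) y := by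
          simpa using (hasDerivAt_neg y).exp
        refine HasDerivAt.congr_deriv (((((hasDerivAt_id y).mul (h1.const_add 1)).div_const 2).sub
          (h1.const_sub 1))) ?_
        simp only [id]
        ring
      refine monotoneOn_of_deriv_nonneg (convex_Ici 0)
        (fun y _ => (hd y).continuousAt.continuousWithinAt)
        (fun y _ => (hd y).differentiableAt.differentiableWithinAt) fun y _ => ?_
      rw [(hd y).deriv]
      have h1 := Real.add_one_le_exp y
      have h2 : Real.exp y * Real.exp (-y) = 1 := by rw [← Real.exp_add]; simp
      have h3 := mul_le_mul_of_nonneg_right h1 (Real.exp_pos (-y)).le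
      nlinarith
    simpa using hm (Set.mem_Ici.2 le_rfl) hy hy
  have := key (κ * x) (by positivity)
  rw [expUtil, div_le_iff₀ hκ, neg_mul]
  linarith

lemma hasDerivAt_expUtil {κ : ℝ} (hκ : κ ≠ 0) (x : ℝ) :
    HasDerivAt (expUtil κ) (Real.exp (-κ * x)) x := by
  have h1 : HasDerivAt (fun y : ℝ => Real.exp (-κ * y)) (Real.exp (-κ * x) * (-κ)) x := by
    simpa using ((hasDerivAt_id x).const_mul (-κ)).exp
  refine HasDerivAt.congr_deriv ((h1.const_sub 1).div_const κ) ?_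
  field_simp

lemma sub_expUtil_le_of_nonpos {η κ : ℝ} (hη : 0 < η) (h : η < κ) {x : ℝ} (hx : x ≤ 0) :
    (1 - η / κ) * (x - expUtil κ x) ≤ expUtil η x - expUtil κ x := by
  have hκ : 0 < κ := hη.trans h
  have hm : AntitoneOn (fun x => expUtil η x - expUtil κ x - (1 - η / κ) * (x - expUtil κ x))
      (Set.Iic 0) := by
    have hd : ∀ x : ℝ, HasDerivAt
        (fun x => expUtil η x - expUtil κ x - (1 - η / κ) * (x - expUtil κ x))
        (Real.exp (-η * x) - Real.exp (-κ * x) - (1 - η / κ) * (1 - Real.exp (-κ * x))) x :=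
      fun x => ((hasDerivAt_expUtil hη.ne' x).sub (hasDerivAt_expUtil hκ.ne' x)).sub
        (((hasDerivAt_id x).sub (hasDerivAt_expUtil hκ.ne' x)).const_mul _)
    refine antitoneOn_of_deriv_nonpos (convex_Iic 0)
      (fun y _ => (hd y).continuousAt.continuousWithinAt)
      (fun y _ => (hd y).differentiableAt.differentiableWithinAt) fun y _ => ?_
    rw [(hd y).deriv]
    have := exp_mul_le_convex_comb (ρ := η / κ) (by positivity) ((div_le_one hκ).2 h.le) (-κ * y)
    have e : η / κ * (-κ * y) = -η * y := by field_simp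
    rw [e] at this
    linarith
  have := hm hx (Set.mem_Iic.2 le_rfl) hx
  simp only [expUtil, mul_zero, Real.exp_zero, sub_self, zero_div] at this
  simp only [expUtil]
  linarith

lemma sub_expUtil_le_of_nonneg {η κ : ℝ} (hη : 0 < η) (h : η < κ) {x : ℝ} (hx : 0 ≤ x) :
    (1 - η / κ) * (x - expUtil κ x) ≤ (1 + η * x) * (expUtil η x - expUtil κ x) := by
  have hκ : 0 < κ := hη.trans h
  have hm : MonotoneOn
      (fun x => (1 + η * x) * (expUtil η x - expUtil κ x) - (1 - η / κ) * (x - expUtil κ x))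
      (Set.Ici 0) := by
    have hd : ∀ x : ℝ, HasDerivAt
        (fun x => (1 + η * x) * (expUtil η x - expUtil κ x) - (1 - η / κ) * (x - expUtil κ x))
        (η * x * (Real.exp (-η * x) - Real.exp (-κ * x))) x := by
      intro x
      refine HasDerivAt.congr_deriv (((((hasDerivAt_id x).const_mul η).const_add 1).mul
        ((hasDerivAt_expUtil hη.ne' x).sub (hasDerivAt_expUtil hκ.ne' x))).sub
        (((hasDerivAt_id x).sub (hasDerivAt_expUtil hκ.ne' x)).const_mul (1 - η / κ))) ?_
      simp only [expUtil, id, Pi.sub_apply]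
      field_simp
      ring
    refine monotoneOn_of_deriv_nonneg (convex_Ici 0)
      (fun y _ => (hd y).continuousAt.continuousWithinAt)
      (fun y _ => (hd y).differentiableAt.differentiableWithinAt) fun y hy => ?_
    rw [interior_Ici] at hy
    have hy : 0 < y := hy
    rw [(hd y).deriv]
    have : Real.exp (-κ * y) ≤ Real.exp (-η * y) := Real.exp_le_exp.2 (by nlinarith)
    exact mul_nonneg (by positivity) (by linarith)
  have := hm (Set.mem_Ici.2 le_rfl) hx hx
  simp only [expUtil, mul_zero, Real.exp_zero, sub_self, zero_div] at this
  simp only [expUtil]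
  linarith

section Pointwise

variable {η κ u C : ℝ}

/-- For `m ≤ 2u` the combination `C h_η - (C - 1) h_κ`, which agrees with the identity to first
order at `0`, dominates the identity. -/
lemma self_le_expUtil_comb (hη : 0 < η) (h : η < κ) (hu : 0 ≤ u)
    (hC : 1 + 2 * η * u ≤ C * (1 - η / κ)) {m : ℝ} (hm : m ≤ 2 * u) :
    m ≤ C * expUtil η m - (C - 1) * expUtil κ m := by
  have hκ : 0 < κ := hη.trans h
  have hρ : 0 < 1 - η / κ := sub_pos.2 ((div_lt_one hκ).2 h)
  have hηu : 0 ≤ η * u := by positivity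
  have hC0 : 0 < C := by
    by_contra hneg
    nlinarith
  have h0 := expUtil_le_self hκ m
  rcases le_total m 0 with h1 | h1
  · have := mul_le_mul_of_nonneg_left (sub_expUtil_le_of_nonpos hη h h1) hC0.le
    nlinarith
  · have h2 := mul_le_mul_of_nonneg_left (sub_expUtil_le_of_nonneg hη h h1) hC0.le
    have h3 : 0 < 1 + η * m := by positivity
    have h4 : (1 + η * m) * (m - expUtil κ m) ≤ C * (1 - η / κ) * (m - expUtil κ m) :=
      mul_le_mul_of_nonneg_right (by nlinarith) (by linarith)
    have h5 : (1 + η * m) * (m - expUtil κ m) ≤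
        (1 + η * m) * (C * (expUtil η m - expUtil κ m)) := by linarith
    have := le_of_mul_le_mul_left h5 h3
    linarith

/-- Beyond `u` the combination still dominates `u + h_κ`.  For arguments above `2u`, where it may
fall below the identity, the trapezoidal bound on `h_κ` compensates. -/
lemma add_expUtil_le_expUtil_comb (hη : 0 < η) (h : η < κ) (hu : 0 ≤ u)
    (hC : 1 + 2 * η * u ≤ C * (1 - η / κ)) (d : ℝ) :
    u + expUtil κ d ≤ C * expUtil η (u + d) - (C - 1) * expUtil κ (u + d) := by
  have hκ : 0 < κ := hη.trans h
  rcases le_or_gt d u with hdu | hdu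
  · have h1 := self_le_expUtil_comb hη h hu hC (m := u + d) (by linarith)
    have h2 := expUtil_le_self hκ d
    linarith
  · have hρ : 0 < 1 - η / κ := sub_pos.2 ((div_lt_one hκ).2 h)
    have hηu : 0 ≤ η * u := by positivity
    have hC0 : 0 < C := by
      by_contra hneg
      nlinarith
    set m := u + d with hmdef
    have hm : 0 < m := by linarith
    have h0 := expUtil_le_self hκ m
    have h2 := mul_le_mul_of_nonneg_left (sub_expUtil_le_of_nonneg hη h hm.le) hC0.le
    have h3 : 0 < 1 + η * m := by positivity
    have h4 : (1 + 2 * η * u) * (m - expUtil κ m) ≤ C * (1 - η / κ) * (m - expUtil κ m) :=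
      mul_le_mul_of_nonneg_right hC (by linarith)
    have h5 : (1 + η * m) * (2 * u * (m - expUtil κ m)) ≤
        (1 + η * m) * (m * (C * (expUtil η m - expUtil κ m))) := by
      have : (1 + η * m) * (2 * u) ≤ m * (1 + 2 * η * u) := by nlinarith
      calc (1 + η * m) * (2 * u * (m - expUtil κ m))
          = ((1 + η * m) * (2 * u)) * (m - expUtil κ m) := by ring
        _ ≤ (m * (1 + 2 * η * u)) * (m - expUtil κ m) :=
            mul_le_mul_of_nonneg_right this (by linarith)
        _ = m * ((1 + 2 * η * u) * (m - expUtil κ m)) := by ring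
        _ ≤ m * ((1 + η * m) * (C * (expUtil η m - expUtil κ m))) :=
            mul_le_mul_of_nonneg_left (by linarith) hm.le
        _ = _ := by ring
    have h6 := le_of_mul_le_mul_left h5 h3
    have h7 := mul_le_mul_of_nonneg_left (expUtil_le_trapezoid hκ hm.le) hu
    -- dividing `h6` by `m` after inserting the trapezoidal bound
    have h8 : m * (u - u * Real.exp (-κ * m)) ≤ m * (C * (expUtil η m - expUtil κ m)) := by
      nlinarith
    have h9 := le_of_mul_le_mul_left h8 hm
    have h10 : expUtil κ m = expUtil κ d + Real.exp (-κ * d) * expUtil κ u := by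
      rw [hmdef, add_comm, expUtil_add]
    have h11 := mul_le_mul_of_nonneg_left (mul_exp_le_expUtil hκ u) (Real.exp_pos (-κ * d)).le
    have h12 : Real.exp (-κ * d) * (u * Real.exp (-κ * u)) = u * Real.exp (-κ * m) := by
      rw [hmdef, mul_add, Real.exp_add]; ring
    linarith

/-- The inequality behind the transfer from exponential moments to the truncated excess loss
`x = m - d`: no relation between `m` and `d` is needed. -/
lemma truncation_le_expUtil (hη : 0 < η) (h : η < κ) (hu : 0 ≤ u)
    (hC : 1 + 2 * η * u ≤ C * (1 - η / κ)) (x d : ℝ) :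
    (if x ≤ u then x else 0) ≤
      C * expUtil η (x + d) - (C - 1) * expUtil κ (x + d) - expUtil κ d := by
  have hκ : 0 < κ := hη.trans h
  have hd := expUtil_le_self hκ d
  split_ifs with hx
  · rcases le_total (x + d) (2 * u) with h1 | h1
    · have := self_le_expUtil_comb hη h hu hC h1
      linarith
    · have h2 := add_expUtil_le_expUtil_comb hη h hu hC (x + d - u)
      rw [add_sub_cancel] at h2
      -- `expUtil κ` is 1-Lipschitz on `[0, ∞)`
      have h3 := expUtil_add κ (x + d - u) (u - x)
      rw [show x + d - u + (u - x) = d by ring] at h3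
      have h4 : 0 ≤ expUtil κ (u - x) := by
        have := expUtil_mono hκ (show 0 ≤ u - x by linarith)
        simpa [expUtil] using this
      have h5 : Real.exp (-κ * (x + d - u)) ≤ 1 := Real.exp_le_one_iff.2 (by nlinarith)
      have h6 := expUtil_le_self hκ (u - x)
      nlinarith
  · push Not at hx
    rcases le_total u (x + d) with h1 | h1
    · have h2 := add_expUtil_le_expUtil_comb hη h hu hC (x + d - u)
      rw [add_sub_cancel] at h2
      have h3 := expUtil_mono hκ (show d ≤ x + d - u by linarith)
      linarith
    · have := self_le_expUtil_comb hη h hu hC (m := x + d) (by linarith)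
      linarith

end Pointwise
/-! ### Reversed information projection -/

/-- Fatou's lemma for nonnegative real functions with convergent bounds on their integrals. -/
lemma lintegral_ofReal_le_of_tendsto {Ω : Type*} [MeasurableSpace Ω] {μ : Measure Ω}
    {f : ℕ → Ω → ℝ} {g : Ω → ℝ} {a : ℕ → ℝ} {b : ℝ}
    (hf : ∀ k, Integrable (f k) μ) (hnn : ∀ k ω, 0 ≤ f k ω) (ha : ∀ k, ∫ ω, f k ω ∂μ ≤ a k)
    (hlim : ∀ᵐ ω ∂μ, Filter.Tendsto (fun k => f k ω) Filter.atTop (nhds (g ω)))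
    (hab : Filter.Tendsto a Filter.atTop (nhds b)) :
    ∫⁻ ω, ENNReal.ofReal (g ω) ∂μ ≤ ENNReal.ofReal b := by
  calc ∫⁻ ω, ENNReal.ofReal (g ω) ∂μ
      = ∫⁻ ω, Filter.liminf (fun k => ENNReal.ofReal (f k ω)) Filter.atTop ∂μ := by
        refine lintegral_congr_ae ?_
        filter_upwards [hlim] with ω hω
        exact ((ENNReal.continuous_ofReal.tendsto _).comp hω).liminf_eq.symm
    _ ≤ Filter.liminf (fun k => ∫⁻ ω, ENNReal.ofReal (f k ω) ∂μ) Filter.atTop :=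
        lintegral_liminf_le' fun k => (hf k).aestronglyMeasurable.aemeasurable.ennreal_ofReal
    _ ≤ Filter.liminf (fun k => ENNReal.ofReal (a k)) Filter.atTop := by
        refine Filter.liminf_le_liminf (Filter.Eventually.of_forall fun k => ?_)
        rw [← ofReal_integral_eq_lintegral_ofReal (hf k) (Filter.Eventually.of_forall (hnn k))]
        exact ENNReal.ofReal_le_ofReal (ha k)
    _ = ENNReal.ofReal b := ((ENNReal.continuous_ofReal.tendsto _).comp hab).liminf_eq

/-- Quantitative concavity of the logarithm at a midpoint. -/
lemma sq_div_le_log_midpoint {a b : ℝ} (ha : 0 < a) (hb : 0 < b) :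
    ((Real.log a - Real.log b) / 2) ^ 2 / (4 + ((Real.log a - Real.log b) / 2) ^ 2) ≤
      Real.log ((a + b) / 2) - Real.log a / 2 - Real.log b / 2 := by
  set A := Real.log a with hA
  set B := Real.log b with hB
  set y := (A - B) / 2 with hy
  have hmid : (a + b) / 2 = Real.exp ((A + B) / 2) * Real.cosh y := by
    rw [Real.cosh_eq, hy, mul_div_assoc', mul_add, ← Real.exp_add, ← Real.exp_add]
    have e1 : (A + B) / 2 + (A - B) / 2 = A := by ring
    have e2 : (A + B) / 2 + -((A - B) / 2) = B := by ring
    rw [e1, e2, hA, hB, Real.exp_log ha, Real.exp_log hb]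
  have hcosh : 1 + y ^ 2 / 4 ≤ Real.cosh y := by
    rw [← Real.cosh_abs, Real.cosh_eq, ← sq_abs]
    have h1 := Real.quadratic_le_exp_of_nonneg (abs_nonneg y)
    have h2 := Real.add_one_le_exp (-|y|)
    linarith
  rw [hmid, Real.log_mul (Real.exp_pos _).ne' (Real.cosh_pos _).ne', Real.log_exp]
  have h3 : 0 < 1 + y ^ 2 / 4 := by positivity
  have h4 := Real.log_le_log h3 hcosh
  have h5 := Real.one_sub_inv_le_log_of_pos h3
  have h6 : 1 - (1 + y ^ 2 / 4)⁻¹ = y ^ 2 / (4 + y ^ 2) := by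
    field_simp
    ring
  linarith

/-- A midpoint gap of at most `4⁻ᵏ` forces geometrically close logarithms. -/
lemma dist_log_le_of_midpoint {a b : ℝ} (ha : 0 < a) (hb : 0 < b) {k : ℕ} (hk : 1 ≤ k)
    (h : 4 ^ k * (Real.log ((a + b) / 2) - Real.log a / 2 - Real.log b / 2) ≤ 1) :
    dist (Real.log a) (Real.log b) ≤ 6 * (1 / 2) ^ k := by
  have h1 := sq_div_le_log_midpoint ha hb
  set y := (Real.log a - Real.log b) / 2 with hy
  have h4 : (4 : ℝ) ≤ 4 ^ k := by
    simpa using pow_le_pow_right₀ (by norm_num : (1 : ℝ) ≤ 4) hk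
  have h2 : (4 : ℝ) ^ k * (y ^ 2 / (4 + y ^ 2)) ≤ 1 :=
    (mul_le_mul_of_nonneg_left h1 (by positivity)).trans h
  rw [mul_div_assoc', div_le_one (by positivity)] at h2
  have h3 : (4 : ℝ) ^ k = 2 ^ k * 2 ^ k := by
    rw [← mul_pow]; norm_num
  have h5 : (2 ^ k * y) ^ 2 ≤ 3 ^ 2 := by
    rw [mul_pow, pow_two ((2 : ℝ) ^ k), ← h3]
    nlinarith [sq_nonneg y]
  have h6 := abs_le_of_sq_le_sq h5 (by norm_num)
  rw [Real.dist_eq, show Real.log a - Real.log b = 2 * y by rw [hy]; ring, abs_mul, abs_two,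
    one_div, inv_pow, ← div_eq_mul_inv, le_div_iff₀ (by positivity)]
  have h7 : |2 ^ k * y| = 2 ^ k * |y| := by
    rw [abs_mul, abs_of_pos (by positivity)]
  have h8 : 2 ^ k * |y| ≤ 3 := h7 ▸ h6
  linarith

/-- If `∫ φ k ≤ 8⁻ᵏ` then almost surely `φ k ≤ 4⁻ᵏ` eventually. -/
lemma ae_eventually_mul_le_one {Ω : Type*} [MeasurableSpace Ω] {μ : Measure Ω}
    {φ : ℕ → Ω → ℝ} (hφ : ∀ k, Integrable (φ k) μ) (hnn : ∀ k ω, 0 ≤ φ k ω)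
    (hint : ∀ k, ∫ ω, φ k ω ∂μ ≤ (1 / 8) ^ k) :
    ∀ᵐ ω ∂μ, ∀ᶠ k in Filter.atTop, (4 : ℝ) ^ k * φ k ω ≤ 1 := by
  have hm : ∀ k, AEMeasurable (fun ω => ENNReal.ofReal (4 ^ k * φ k ω)) μ := fun k =>
    ((hφ k).aestronglyMeasurable.aemeasurable.const_mul _).ennreal_ofReal
  have hsum : ∫⁻ ω, ∑' k, ENNReal.ofReal (4 ^ k * φ k ω) ∂μ ≠ ⊤ := by
    rw [lintegral_tsum hm]
    have hs : Summable fun k : ℕ => (1 / 2 : ℝ) ^ k := summable_geometric_two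
    refine ne_top_of_le_ne_top hs.tsum_ofReal_ne_top (ENNReal.tsum_le_tsum fun k => ?_)
    rw [← ofReal_integral_eq_lintegral_ofReal ((hφ k).const_mul _)
      (Filter.Eventually.of_forall fun ω => mul_nonneg (by positivity) (hnn k ω)),
      integral_const_mul]
    refine ENNReal.ofReal_le_ofReal ?_
    calc (4 : ℝ) ^ k * ∫ ω, φ k ω ∂μ ≤ 4 ^ k * (1 / 8) ^ k := by gcongr; exact hint k
      _ = (1 / 2) ^ k := by rw [← mul_pow]; norm_num
  filter_upwards [ae_lt_top' (AEMeasurable.tsum hm) hsum] with ω hω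
  have := ENNReal.tendsto_atTop_zero_of_tsum_ne_top hω.ne
  filter_upwards [this.eventually (gt_mem_nhds zero_lt_one)] with k hk
  by_contra hcon
  rw [← ENNReal.ofReal_one, ENNReal.ofReal_lt_ofReal_iff one_pos] at hk
  exact hcon hk.le

section Projection

variable {Z : Type*} [MeasurableSpace Z] {P : Measure Z}
  {T : Set (Z → ℝ)} {s δ : ℝ}

/-- A near-maximizer `q` of the expected logarithm cannot be improved much by mixing in `r`. -/
lemma integral_log_one_add_le [IsProbabilityMeasure P] (hconv : Convex ℝ T)
    (hnn : ∀ r ∈ T, ∀ z, 0 ≤ r z)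
    (hint : ∀ r ∈ T, ∀ δ > 0, (∀ z, δ ≤ r z) → Integrable (fun z => Real.log (r z)) P)
    (hsup : ∀ r ∈ T, ∀ δ > 0, (∀ z, δ ≤ r z) → ∫ z, Real.log (r z) ∂P ≤ s)
    {q r : Z → ℝ} (hq : q ∈ T) {d : ℝ} (hd : 0 < d) (hqd : ∀ z, d ≤ q z)
    (hqs : s - δ ≤ ∫ z, Real.log (q z) ∂P) (hr : r ∈ T) {τ : ℝ} (hτ : 0 < τ) :
    Integrable (fun z => Real.log (1 + τ * (r z / q z))) P ∧
      ∫ z, Real.log (1 + τ * (r z / q z)) ∂P ≤ δ + Real.log (1 + τ) := by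
  have hmem : ((1 + τ)⁻¹ • q + (τ / (1 + τ)) • r) ∈ T :=
    hconv hq hr (by positivity) (by positivity) (by field_simp)
  have hpos : ∀ z, 0 < q z := fun z => hd.trans_le (hqd z)
  have hlow : ∀ z, (1 + τ)⁻¹ * d ≤ ((1 + τ)⁻¹ • q + (τ / (1 + τ)) • r) z := by
    intro z
    have h1 : (1 + τ)⁻¹ * d ≤ (1 + τ)⁻¹ * q z := by gcongr; exact hqd z
    have h2 : 0 ≤ τ / (1 + τ) * r z := mul_nonneg (by positivity) (hnn r hr z)
    simp only [Pi.add_apply, Pi.smul_apply, smul_eq_mul]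
    linarith
  have hlog : ∀ z, Real.log (1 + τ * (r z / q z)) =
      Real.log (((1 + τ)⁻¹ • q + (τ / (1 + τ)) • r) z) - Real.log (q z) + Real.log (1 + τ) := by
    intro z
    have h1 : ((1 + τ)⁻¹ • q + (τ / (1 + τ)) • r) z =
        (1 + τ)⁻¹ * q z * (1 + τ * (r z / q z)) := by
      have := (hpos z).ne'
      simp only [Pi.add_apply, Pi.smul_apply, smul_eq_mul]
      field_simp
    have h2 : 0 < 1 + τ * (r z / q z) := by
      have := div_nonneg (hnn r hr z) (hpos z).le
      positivity
    rw [h1, Real.log_mul (by have := hpos z; positivity) h2.ne',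
      Real.log_mul (by positivity) (hpos z).ne', Real.log_inv]
    ring
  have hi1 := hint _ hmem _ (by positivity) hlow
  have hi2 := hint q hq d hd hqd
  have hi12 : Integrable (fun z => Real.log (((1 + τ)⁻¹ • q + (τ / (1 + τ)) • r) z) -
      Real.log (q z)) P := hi1.sub hi2
  have h3 := hsup _ hmem _ (by positivity) hlow
  simp_rw [hlog]
  refine ⟨hi12.add (integrable_const _), ?_⟩
  rw [integral_add hi12 (integrable_const _), integral_sub hi1 hi2]
  simp only [integral_const, probReal_univ, one_smul]
  linarith

/-- Among the members of `T` bounded away from zero there is a sequence that maximizes the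
expected logarithm and converges almost surely to a positive limit. -/
lemma exists_maximizing_seq (hconv : Convex ℝ T) (h1 : (fun _ => 1) ∈ T)
    (hmeas : ∀ r ∈ T, Measurable r) {b : ℝ}
    (hb : ∀ r ∈ T, ∀ δ > 0, (∀ z, δ ≤ r z) →
      Integrable (fun z => Real.log (r z)) P ∧ ∫ z, Real.log (r z) ∂P ≤ b) :
    ∃ s ≤ b, (∀ r ∈ T, ∀ δ > 0, (∀ z, δ ≤ r z) → ∫ z, Real.log (r z) ∂P ≤ s) ∧
      ∃ q : ℕ → Z → ℝ, (∀ k, q k ∈ T ∧ (∃ d > 0, ∀ z, d ≤ q k z) ∧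
        s - (1 / 8) ^ k ≤ ∫ z, Real.log (q k z) ∂P) ∧
      ∃ G : Z → ℝ, Measurable G ∧ (∀ z, 0 < G z) ∧
        ∀ᵐ z ∂P, Filter.Tendsto (fun k => q k z) Filter.atTop (nhds (G z)) := by
  set S : Set ℝ := {x | ∃ r ∈ T, (∃ d > 0, ∀ z, d ≤ r z) ∧ ∫ z, Real.log (r z) ∂P = x} with hS
  have hSne : S.Nonempty := ⟨_, _, h1, ⟨1, one_pos, fun _ => le_rfl⟩, rfl⟩
  have hSb : ∀ x ∈ S, x ≤ b := by
    rintro x ⟨r, hr, ⟨d, hd, hrd⟩, rfl⟩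
    exact (hb r hr d hd hrd).2
  have hSbdd : BddAbove S := ⟨b, hSb⟩
  have hsup : ∀ r ∈ T, ∀ δ > 0, (∀ z, δ ≤ r z) → ∫ z, Real.log (r z) ∂P ≤ sSup S :=
    fun r hr d hd hrd => le_csSup hSbdd ⟨r, hr, ⟨d, hd, hrd⟩, rfl⟩
  refine ⟨sSup S, csSup_le hSne hSb, hsup, ?_⟩
  have hex : ∀ k : ℕ, ∃ q ∈ T, (∃ d > 0, ∀ z, d ≤ q z) ∧
      sSup S - (1 / 8) ^ k ≤ ∫ z, Real.log (q z) ∂P := by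
    intro k
    obtain ⟨x, ⟨r, hr, hd, rfl⟩, hx⟩ := exists_lt_of_lt_csSup hSne
      (sub_lt_self (sSup S) (by positivity : (0 : ℝ) < (1 / 8) ^ k))
    exact ⟨r, hr, hd, hx.le⟩
  choose q hqT hqd hqs using hex
  refine ⟨q, fun k => ⟨hqT k, hqd k, hqs k⟩, ?_⟩
  have hpos : ∀ k z, 0 < q k z := fun k z => by
    obtain ⟨d, hd, h⟩ := hqd k
    exact hd.trans_le (h z)
  have hqi : ∀ k, Integrable (fun z => Real.log (q k z)) P := fun k => by
    obtain ⟨d, hd, h⟩ := hqd k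
    exact (hb _ (hqT k) d hd h).1
  have hmid : ∀ k, ((1 / 2 : ℝ) • q k + (1 / 2 : ℝ) • q (k + 1)) ∈ T := fun k =>
    hconv (hqT k) (hqT (k + 1)) (by norm_num) (by norm_num) (by norm_num)
  have hmidlow : ∀ k, ∃ d > 0, ∀ z, d ≤ ((1 / 2 : ℝ) • q k + (1 / 2 : ℝ) • q (k + 1)) z := by
    intro k
    obtain ⟨d, hd, h⟩ := hqd k
    refine ⟨d / 2, by positivity, fun z => ?_⟩
    have := h z
    have := (hpos (k + 1) z).le
    simp only [Pi.add_apply, Pi.smul_apply, smul_eq_mul]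
    linarith
  have hmideq : ∀ k z, ((1 / 2 : ℝ) • q k + (1 / 2 : ℝ) • q (k + 1)) z =
      (q k z + q (k + 1) z) / 2 := by
    intro k z
    simp only [Pi.add_apply, Pi.smul_apply, smul_eq_mul]
    ring
  have hgapi : ∀ k, Integrable (fun z => Real.log ((q k z + q (k + 1) z) / 2)) P ∧
      ∫ z, Real.log ((q k z + q (k + 1) z) / 2) ∂P ≤ sSup S := by
    intro k
    obtain ⟨d, hd, h⟩ := hmidlow k
    simp_rw [← hmideq]
    exact ⟨(hb _ (hmid k) d hd h).1, hsup _ (hmid k) d hd h⟩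
  have hgapi' : ∀ k, Integrable (fun z => Real.log ((q k z + q (k + 1) z) / 2) -
      Real.log (q k z) / 2) P := fun k => (hgapi k).1.sub ((hqi k).div_const 2)
  -- near-maximality of two consecutive members bounds the concavity gap at their midpoint
  have hev := ae_eventually_mul_le_one (μ := P)
    (φ := fun k z => Real.log ((q k z + q (k + 1) z) / 2) - Real.log (q k z) / 2 -
      Real.log (q (k + 1) z) / 2)
    (fun k => (hgapi' k).sub ((hqi (k + 1)).div_const 2))
    (fun k z => (by positivity : (0 : ℝ) ≤ _).trans
      (sq_div_le_log_midpoint (hpos k z) (hpos (k + 1) z)))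
    (fun k => by
      rw [integral_sub (hgapi' k) ((hqi (k + 1)).div_const 2),
        integral_sub (hgapi k).1 ((hqi k).div_const 2), integral_div, integral_div]
      have e1 := (hgapi k).2
      have e2 := hqs k
      have e3 := hqs (k + 1)
      have e4 : (1 / 8 : ℝ) ^ (k + 1) ≤ (1 / 8) ^ k :=
        pow_le_pow_of_le_one (by norm_num) (by norm_num) (Nat.le_succ k)
      linarith)
  have hcau : ∀ᵐ z ∂P, ∃ l : ℝ,
      Filter.Tendsto (fun k => Real.log (q k z)) Filter.atTop (nhds l) := by
    filter_upwards [hev] with z hz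
    refine cauchySeq_tendsto_of_complete (cauchySeq_of_summable_dist ?_)
    refine Summable.of_norm_bounded_eventually_nat
      (summable_geometric_two.mul_left 6) ?_
    filter_upwards [hz, Filter.eventually_ge_atTop 1] with k hk hk1
    rw [Real.norm_of_nonneg dist_nonneg]
    exact dist_log_le_of_midpoint (hpos k z) (hpos (k + 1) z) hk1 hk
  obtain ⟨g, hg, hglim⟩ := measurable_limit_of_tendsto_metrizable_ae
    (fun k => ((hmeas _ (hqT k)).log).aemeasurable) hcau
  refine ⟨fun z => Real.exp (g z), hg.exp, fun z => Real.exp_pos _, ?_⟩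
  filter_upwards [hglim] with z hz
  refine ((Real.continuous_exp.tendsto _).comp hz).congr fun k => ?_
  simp [Real.exp_log (hpos k z)]

/-- Existence of the reversed information projection.  A convex set `T` of nonnegative functions
containing `1` and with expected logarithms bounded above has a log-optimal limit `G`, and every
member of `T` is an e-variable relative to it: `E[r / G] ≤ 1`. -/
theorem exists_reversed_projection [IsProbabilityMeasure P] (hconv : Convex ℝ T)
    (h1 : (fun _ => 1) ∈ T)
    (hmeas : ∀ r ∈ T, Measurable r) (hnn : ∀ r ∈ T, ∀ z, 0 ≤ r z) {b : ℝ}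
    (hb : ∀ r ∈ T, ∀ δ > 0, (∀ z, δ ≤ r z) →
      Integrable (fun z => Real.log (r z)) P ∧ ∫ z, Real.log (r z) ∂P ≤ b) :
    ∃ G : Z → ℝ, Measurable G ∧ (∀ z, 0 < G z) ∧ Integrable (fun z => Real.log (G z)) P ∧
      ∫ z, Real.log (G z) ∂P ≤ b ∧
      ∀ r ∈ T, ∫⁻ z, ENNReal.ofReal (r z / G z) ∂P ≤ 1 := by
  obtain ⟨s, hsb, hsup, q, hq, G, hG, hGpos, hlim⟩ := exists_maximizing_seq hconv h1 hmeas hb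
  have hpos : ∀ k z, 0 < q k z := fun k z => by
    obtain ⟨d, hd, h⟩ := (hq k).2.1
    exact hd.trans_le (h z)
  have hgeom : Filter.Tendsto (fun k : ℕ => (1 / 8 : ℝ) ^ k) Filter.atTop (nhds 0) :=
    tendsto_pow_atTop_nhds_zero_of_lt_one (by norm_num) (by norm_num)
  -- mixing `r` into the maximizing sequence, in the limit
  have hratio : ∀ r ∈ T, ∀ τ > 0, ∫⁻ z, ENNReal.ofReal (Real.log (1 + τ * (r z / G z))) ∂P ≤
      ENNReal.ofReal (Real.log (1 + τ)) := by
    intro r hr τ hτ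
    have hk : ∀ k, Integrable (fun z => Real.log (1 + τ * (r z / q k z))) P ∧
        ∫ z, Real.log (1 + τ * (r z / q k z)) ∂P ≤ (1 / 8) ^ k + Real.log (1 + τ) := by
      intro k
      obtain ⟨hqT, ⟨d, hd, hqd⟩, hqs⟩ := hq k
      exact integral_log_one_add_le hconv hnn (fun r hr δ hδ h => (hb r hr δ hδ h).1) hsup hqT hd
        hqd hqs hr hτ
    refine lintegral_ofReal_le_of_tendsto (fun k => (hk k).1) (fun k z => ?_) (fun k => (hk k).2)
      ?_ (by simpa using hgeom.add_const (Real.log (1 + τ)))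
    · have := div_nonneg (hnn r hr z) (hpos k z).le
      exact Real.log_nonneg (by nlinarith)
    · filter_upwards [hlim] with z hz
      have h0 := div_nonneg (hnn r hr z) (hGpos z).le
      have h2 : 1 + τ * (r z / G z) ≠ 0 := by positivity
      exact (Real.continuousAt_log h2).tendsto.comp
        ((((tendsto_const_nhds.div hz (hGpos z).ne').const_mul τ)).const_add 1)
  have hE : ∀ r ∈ T, ∫⁻ z, ENNReal.ofReal (r z / G z) ∂P ≤ 1 := by
    intro r hr
    -- divide by `τ` and let `τ → 0`
    have hτpos : ∀ k : ℕ, (0 : ℝ) < (1 / 8) ^ k := fun k => by positivity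
    have hm : Measurable fun z => r z / G z := (hmeas r hr).div hG
    have hnn' : ∀ z, 0 ≤ r z / G z := fun z => div_nonneg (hnn r hr z) (hGpos z).le
    have hlog0 : ∀ k z, 0 ≤ Real.log (1 + (1 / 8) ^ k * (r z / G z)) := fun k z =>
      Real.log_nonneg (by have := mul_nonneg (hτpos k).le (hnn' z); linarith)
    have hi : ∀ k : ℕ, Integrable (fun z => Real.log (1 + (1 / 8) ^ k * (r z / G z))) P :=
      fun k => (lintegral_ofReal_ne_top_iff_integrable
        ((hm.const_mul _).const_add 1).log.aestronglyMeasurable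
        (Filter.Eventually.of_forall (hlog0 k))).1
        (ne_top_of_le_ne_top ENNReal.ofReal_ne_top (hratio r hr _ (hτpos k)))
    rw [← ENNReal.ofReal_one]
    refine lintegral_ofReal_le_of_tendsto
      (f := fun k z => Real.log (1 + (1 / 8) ^ k * (r z / G z)) / (1 / 8) ^ k)
      (fun k => (hi k).div_const _)
      (fun k z => div_nonneg (hlog0 k z) (hτpos k).le) (a := fun _ => 1) (fun k => ?_) ?_
      tendsto_const_nhds
    · rw [integral_div, div_le_one (hτpos k)]
      have h2 := hratio r hr _ (hτpos k)
      rw [← ofReal_integral_eq_lintegral_ofReal (hi k) (Filter.Eventually.of_forall (hlog0 k)),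
        ENNReal.ofReal_le_ofReal_iff (Real.log_nonneg (by linarith [hτpos k]))] at h2
      have h3 := Real.log_le_sub_one_of_pos (show 0 < 1 + (1 / 8 : ℝ) ^ k by positivity)
      linarith
    · refine Filter.Eventually.of_forall fun z => ?_
      have hd : HasDerivAt (fun t : ℝ => Real.log (1 + t * (r z / G z))) (r z / G z) 0 := by
        have h4 := (((hasDerivAt_id (0 : ℝ)).mul_const (r z / G z)).const_add 1).log (by simp)
        simpa using h4
      have h5 := (hasDerivAt_iff_tendsto_slope_zero.1 hd).comp
        (tendsto_nhdsWithin_iff.2 ⟨hgeom, Filter.Eventually.of_forall fun k => (hτpos k).ne'⟩)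
      refine h5.congr fun k => ?_
      simp [div_eq_inv_mul]
  -- mixing in the constant `1` bounds the logarithms from below, so that Fatou's lemma applies
  have hup : ∀ τ > 0, Integrable (fun z => Real.log (1 + G z / τ)) P ∧
      ∫ z, Real.log (1 + G z / τ) ∂P ≤ s + Real.log (1 + τ) - Real.log τ := by
    intro τ hτ
    have hadd : ∀ k, Integrable (fun z => Real.log (1 + q k z / τ)) P ∧
        ∫ z, Real.log (1 + q k z / τ) ∂P ≤ s + Real.log (1 + τ) - Real.log τ := by
      intro k
      obtain ⟨hqT, ⟨d, hd, hqd⟩, -⟩ := hq k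
      have := integral_log_one_add_le (s := s) (δ := s) hconv hnn
        (fun r hr δ hδ h => (hb r hr δ hδ h).1) hsup h1 one_pos (fun _ => le_rfl) (by simp) hqT
        (inv_pos.2 hτ)
      have e : ∀ z, 1 + τ⁻¹ * (q k z / 1) = 1 + q k z / τ := fun z => by ring
      simp_rw [e] at this
      refine ⟨this.1, this.2.trans_eq ?_⟩
      rw [show 1 + τ⁻¹ = (1 + τ) / τ by field_simp; ring, Real.log_div (by positivity) hτ.ne']
      ring
    have hnn' : ∀ z, 0 ≤ Real.log (1 + G z / τ) := fun z =>
      Real.log_nonneg (by have := hGpos z; have : 0 < G z / τ := by positivity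
                          linarith)
    have hle : ∫⁻ z, ENNReal.ofReal (Real.log (1 + G z / τ)) ∂P ≤
        ENNReal.ofReal (s + Real.log (1 + τ) - Real.log τ) := by
      refine lintegral_ofReal_le_of_tendsto (fun k => (hadd k).1) (fun k z => ?_)
        (fun k => (hadd k).2) ?_ tendsto_const_nhds
      · have := hpos k z
        have : 0 < q k z / τ := by positivity
        exact Real.log_nonneg (by linarith)
      · filter_upwards [hlim] with z hz
        have := hGpos z
        have h2 : 1 + G z / τ ≠ 0 := by positivity
        exact (Real.continuousAt_log h2).tendsto.comp ((hz.div_const τ).const_add 1)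
    have hi : Integrable (fun z => Real.log (1 + G z / τ)) P :=
      (lintegral_ofReal_ne_top_iff_integrable
        ((hG.div_const τ).const_add 1).log.aestronglyMeasurable
        (Filter.Eventually.of_forall hnn')).1 (ne_top_of_le_ne_top ENNReal.ofReal_ne_top hle)
    refine ⟨hi, ?_⟩
    rw [← ofReal_integral_eq_lintegral_ofReal hi (Filter.Eventually.of_forall hnn')] at hle
    refine (ENNReal.ofReal_le_ofReal_iff ?_).1 hle
    refine le_trans ?_ (hadd 0).2
    refine integral_nonneg fun z => ?_
    have := hpos 0 z
    have : 0 < q 0 z / τ := by positivity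
    exact Real.log_nonneg (by linarith)
  have hGinv : Integrable (fun z => 1 / G z) P :=
    (lintegral_ofReal_ne_top_iff_integrable (hG.const_div 1).aestronglyMeasurable
      (Filter.Eventually.of_forall fun z => (one_div_pos.2 (hGpos z)).le)).1
      (ne_top_of_le_ne_top ENNReal.one_ne_top (hE _ h1))
  have hlogG : Integrable (fun z => Real.log (G z)) P := by
    refine ((hup 1 one_pos).1.add hGinv).mono' hG.log.aestronglyMeasurable
      (Filter.Eventually.of_forall fun z => ?_)
    have hz := hGpos z
    have h2 := Real.log_le_log hz (show G z ≤ 1 + G z / 1 by simp)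
    have h3 := Real.one_sub_inv_le_log_of_pos hz
    have h4 : 0 ≤ Real.log (1 + G z / 1) := Real.log_nonneg (by simp [hz.le])
    have h5 : 0 < 1 / G z := by positivity
    rw [Real.norm_eq_abs, abs_le, Pi.add_apply]
    rw [← one_div] at h3
    constructor <;> linarith
  refine ⟨G, hG, hGpos, hlogG, ?_, hE⟩
  have hτ : ∀ τ > 0, ∫ z, Real.log (G z) ∂P ≤ s + Real.log (1 + τ) := by
    intro τ hτ
    have h2 : ∫ z, (Real.log (G z) - Real.log τ) ∂P ≤ ∫ z, Real.log (1 + G z / τ) ∂P := by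
      refine integral_mono (hlogG.sub (integrable_const _)) (hup τ hτ).1 fun z => ?_
      have hz := hGpos z
      simp only
      rw [← Real.log_div hz.ne' hτ.ne']
      exact Real.log_le_log (by positivity) (by linarith)
    rw [integral_sub hlogG (integrable_const _)] at h2
    simp at h2
    linarith [(hup τ hτ).2]
  refine le_trans ?_ hsb
  refine le_of_forall_pos_le_add fun ε hε => (hτ ε hε).trans ?_
  have := Real.log_le_sub_one_of_pos (show 0 < 1 + ε by positivity)
  linarith

end Projection
/-! ### Extended-real expectations -/

section Expect

variable {Ω : Type*} [MeasurableSpace Ω] {μ : Measure Ω} {U V : Ω → EReal}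

lemma expect_mono_ae (h : U ≤ᵐ[μ] V) : expect μ U ≤ expect μ V := by
  refine EReal.sub_le_sub ?_ ?_
  · refine EReal.coe_ennreal_le_coe_ennreal_iff.2 (lintegral_mono_ae ?_)
    filter_upwards [h] with ω hω using EReal.toENNReal_le_toENNReal hω
  · refine EReal.coe_ennreal_le_coe_ennreal_iff.2 (lintegral_mono_ae ?_)
    filter_upwards [h] with ω hω using EReal.toENNReal_le_toENNReal (EReal.neg_le_neg_iff.2 hω)

lemma expect_congr_ae (h : U =ᵐ[μ] V) : expect μ U = expect μ V :=
  le_antisymm (expect_mono_ae h.le) (expect_mono_ae h.symm.le)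

lemma expect_coe {g : Ω → ℝ} (hg : Integrable g μ) :
    expect μ (fun ω => (g ω : EReal)) = ((∫ ω, g ω ∂μ : ℝ) : EReal) := by
  have h1 : ∫⁻ ω, ENNReal.ofReal (g ω) ∂μ ≠ ⊤ := hg.lintegral_lt_top.ne
  have h2 : ∫⁻ ω, ENNReal.ofReal (-g ω) ∂μ ≠ ⊤ := hg.neg.lintegral_lt_top.ne
  rw [expect, integral_eq_lintegral_pos_part_sub_lintegral_neg_part hg, EReal.coe_sub,
    EReal.coe_ennreal_toReal h1, EReal.coe_ennreal_toReal h2]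
  simp only [← EReal.coe_neg, EReal.real_coe_toENNReal]

lemma integral_le_expect {g : Ω → ℝ} (hg : Integrable g μ) (h : ∀ᵐ ω ∂μ, (g ω : EReal) ≤ U ω) :
    ((∫ ω, g ω ∂μ : ℝ) : EReal) ≤ expect μ U :=
  expect_coe hg ▸ expect_mono_ae h

lemma expect_le_integral {g : Ω → ℝ} (hg : Integrable g μ) (h : ∀ᵐ ω ∂μ, U ω ≤ (g ω : EReal)) :
    expect μ U ≤ ((∫ ω, g ω ∂μ : ℝ) : EReal) :=
  expect_coe hg ▸ expect_mono_ae h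

/-- A random variable with finite expectation is integrable. -/
lemma integrable_of_expect (hU : AEMeasurable U μ) (hbot : expect μ U ≠ ⊥)
    (htop : expect μ U ≠ ⊤) :
    Integrable (fun ω => (U ω).toReal) μ ∧ (∀ᵐ ω ∂μ, U ω = ((U ω).toReal : EReal)) ∧
      expect μ U = ((∫ ω, (U ω).toReal ∂μ : ℝ) : EReal) := by
  have hneg : ∫⁻ ω, (-U ω).toENNReal ∂μ ≠ ⊤ := by
    intro h
    rw [expect, h] at hbot
    simp at hbot
  have hpos : ∫⁻ ω, (U ω).toENNReal ∂μ ≠ ⊤ := by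
    intro h
    rw [expect, h, EReal.coe_ennreal_top, ← EReal.coe_ennreal_toReal hneg,
      EReal.top_sub_coe] at htop
    exact htop rfl
  have hne : ∀ᵐ ω ∂μ, U ω = ((U ω).toReal : EReal) := by
    filter_upwards [ae_lt_top' hU.ereal_toENNReal hpos,
      ae_lt_top' (hU.neg).ereal_toENNReal hneg] with ω h1 h2
    refine (EReal.coe_toReal ?_ ?_).symm
    · exact EReal.toENNReal_ne_top_iff.1 h1.ne
    · intro h
      simp [h] at h2
  have hint : Integrable (fun ω => (U ω).toReal) μ := by
    refine ⟨hU.ereal_toReal.aestronglyMeasurable, ?_⟩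
    rw [hasFiniteIntegral_iff_norm]
    refine lt_of_le_of_lt (lintegral_mono_ae (g := fun ω => (U ω).toENNReal + (-U ω).toENNReal) ?_)
      ?_
    · filter_upwards [hne] with ω hω
      rw [hω, ← EReal.coe_neg, EReal.real_coe_toENNReal, EReal.real_coe_toENNReal,
        EReal.toReal_coe, Real.norm_eq_abs]
      rcases le_total 0 (U ω).toReal with h | h
      · rw [abs_of_nonneg h]; exact le_self_add
      · rw [abs_of_nonpos h]; exact le_add_self
    · rw [lintegral_add_left' hU.ereal_toENNReal]
      exact ENNReal.add_lt_top.2 ⟨hpos.lt_top, hneg.lt_top⟩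
  exact ⟨hint, hne, (expect_congr_ae hne).trans (expect_coe hint)⟩

lemma measurable_expect_kernel {α : Type*} [MeasurableSpace α] {κ : Kernel α Ω}
    [IsSFiniteKernel κ] {U : α → Ω → EReal} (hU : Measurable (Function.uncurry U)) :
    Measurable fun a => expect (κ a) (U a) := by
  have h1 : Measurable fun a => ∫⁻ ω, (U a ω).toENNReal ∂κ a :=
    Measurable.lintegral_kernel_prod_right hU.ereal_toENNReal
  have h2 : Measurable fun a => ∫⁻ ω, (-U a ω).toENNReal ∂κ a :=
    Measurable.lintegral_kernel_prod_right hU.neg.ereal_toENNReal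
  unfold expect
  simp_rw [sub_eq_add_neg]
  exact h1.coe_ereal_ennreal.add h2.coe_ereal_ennreal.neg

end Expect

/-! ### Sums of extended reals -/

lemma sum_ne_bot {ι : Type*} (s : Finset ι) {x : ι → EReal} (h : ∀ i ∈ s, x i ≠ ⊥) :
    ∑ i ∈ s, x i ≠ ⊥ := by
  classical
  induction s using Finset.induction_on with
  | empty => simp
  | insert a s ha ih =>
    rw [Finset.sum_insert ha]
    exact EReal.add_ne_bot_iff.2 ⟨h a (by simp), ih fun i hi => h i (by simp [hi])⟩

lemma sum_eq_top {ι : Type*} (s : Finset ι) {x : ι → EReal} (h : ∀ i ∈ s, x i ≠ ⊥) {i : ι}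
    (hi : i ∈ s) (hx : x i = ⊤) : ∑ i ∈ s, x i = ⊤ := by
  classical
  rw [← Finset.add_sum_erase s x hi, hx, EReal.top_add_of_ne_bot]
  exact sum_ne_bot _ fun j hj => h j (Finset.mem_of_mem_erase hj)

lemma coe_sum_real {ι : Type*} (s : Finset ι) (x : ι → ℝ) :
    ((∑ i ∈ s, x i : ℝ) : EReal) = ∑ i ∈ s, (x i : EReal) :=
  map_sum (⟨⟨Real.toEReal, rfl⟩, EReal.coe_add⟩ : ℝ →+ EReal) x s

/-! ### The Donsker–Varadhan inequality -/

section DonskerVaradhan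

variable {Ω : Type*} [MeasurableSpace Ω]

lemma ofReal_exp_integral_le {μ : Measure Ω} [IsProbabilityMeasure μ] {x : Ω → ℝ}
    (hx : Integrable x μ) :
    ENNReal.ofReal (Real.exp (∫ ω, x ω ∂μ)) ≤ ∫⁻ ω, ENNReal.ofReal (Real.exp (x ω)) ∂μ := by
  by_cases htop : ∫⁻ ω, ENNReal.ofReal (Real.exp (x ω)) ∂μ = ⊤
  · simp [htop]
  have hexp : Integrable (fun ω => Real.exp (x ω)) μ :=
    (lintegral_ofReal_ne_top_iff_integrable
      (Real.continuous_exp.comp_aestronglyMeasurable hx.aestronglyMeasurable)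
      (Filter.Eventually.of_forall fun ω => (Real.exp_pos _).le)).1 htop
  rw [← ofReal_integral_eq_lintegral_ofReal hexp
    (Filter.Eventually.of_forall fun ω => (Real.exp_pos _).le)]
  exact ENNReal.ofReal_le_ofReal (convexOn_exp.map_integral_le Real.continuous_exp.continuousOn
    isClosed_univ (by simp) hx hexp)

/-- The Donsker–Varadhan inequality, with `W` dominating `exp g` only where `μ` sees it. -/
lemma ofReal_exp_integral_sub_klDiv_le {μ ν : Measure Ω} [IsProbabilityMeasure μ]
    [IsProbabilityMeasure ν] (hkl : InformationTheory.klDiv μ ν ≠ ⊤) {g : Ω → ℝ}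
    (hg : Integrable g μ) {W : Ω → ENNReal} (hW : Measurable W)
    (hgW : ∀ᵐ ω ∂μ, ENNReal.ofReal (Real.exp (g ω)) ≤ W ω) :
    ENNReal.ofReal (Real.exp (∫ ω, g ω ∂μ - (InformationTheory.klDiv μ ν).toReal)) ≤
      ∫⁻ ω, W ω ∂ν := by
  obtain ⟨hac, hllr⟩ := InformationTheory.klDiv_ne_top_iff.1 hkl
  rw [InformationTheory.toReal_klDiv_of_measure_eq hac (by simp), ← integral_sub hg hllr]
  refine (ofReal_exp_integral_le (hg.sub hllr)).trans ?_
  calc ∫⁻ ω, ENNReal.ofReal (Real.exp (g ω - llr μ ν ω)) ∂μ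
      ≤ ∫⁻ ω, ν.rnDeriv μ ω * W ω ∂μ := by
        refine lintegral_mono_ae ?_
        filter_upwards [hgW, exp_neg_llr hac] with ω h1 h2
        rw [sub_eq_add_neg, Real.exp_add, ENNReal.ofReal_mul (Real.exp_pos _).le, h2, mul_comm]
        exact mul_le_mul' ENNReal.ofReal_toReal_le h1
    _ = ∫⁻ ω, W ω ∂(μ.withDensity (ν.rnDeriv μ)) := by
        rw [lintegral_withDensity_eq_lintegral_mul _ (Measure.measurable_rnDeriv _ _) hW]
        rfl
    _ ≤ ∫⁻ ω, W ω ∂ν := lintegral_mono' (Measure.withDensity_rnDeriv_le _ _) le_rfl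

end DonskerVaradhan

lemma lintegral_pi_prod {Z : Type*} [MeasurableSpace Z] (P : Measure Z) [IsProbabilityMeasure P]
    (n : ℕ) {h : Z → ENNReal} (hh : Measurable h) :
    ∫⁻ zs, ∏ i, h (zs i) ∂(Measure.pi fun _ : Fin n => P) = (∫⁻ z, h z ∂P) ^ n := by
  have hind : iIndepFun (fun (i : Fin n) (zs : Fin n → Z) => h (zs i))
      (Measure.pi fun _ : Fin n => P) :=
    iIndepFun_pi (X := fun _ => h) fun _ => hh.aemeasurable
  have := lintegral_prod_eq_prod_lintegral_of_indepFun Finset.univ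
    (fun (i : Fin n) (zs : Fin n → Z) => h (zs i)) hind
    (fun i => hh.comp (measurable_pi_apply i))
  rw [this]
  have hi : ∀ i : Fin n, ∫⁻ zs, h (zs i) ∂(Measure.pi fun _ : Fin n => P) = ∫⁻ z, h z ∂P :=
    fun i => (measurePreserving_eval (fun _ : Fin n => P) i).lintegral_comp hh
  simp [hi]

/-! ### Excess risk under an offset -/

/-- The extended exponential `e^{-κx}` as a real number, equal to `0` at `x = ∞`.  At `x = -∞`,
which excess losses avoid almost surely, the value is the irrelevant `1`. -/
noncomputable def negExp (κ : ℝ) (x : EReal) : ℝ :=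
  open Classical in if x = ⊤ then 0 else Real.exp (-κ * x.toReal)

@[simp] lemma negExp_top (κ : ℝ) : negExp κ ⊤ = 0 := by simp [negExp]

@[simp] lemma negExp_coe (κ x : ℝ) : negExp κ (x : EReal) = Real.exp (-κ * x) := by
  simp [negExp]

lemma negExp_nonneg (κ : ℝ) (x : EReal) : 0 ≤ negExp κ x := by
  unfold negExp
  split_ifs
  · exact le_rfl
  · exact (Real.exp_pos _).le

lemma measurable_negExp (κ : ℝ) : Measurable (negExp κ) :=
  Measurable.ite (measurableSet_singleton _) measurable_const
    (measurable_ereal_toReal.const_mul (-κ)).exp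

namespace LearningProblem

variable {Z F : Type*} [MeasurableSpace Z] [MeasurableSpace F]

lemma measurable_excessLoss (L : LearningProblem Z F) (fstar : F) :
    Measurable (Function.uncurry (L.excessLoss fstar)) := by
  have h1 : Measurable fun p : F × Z => L.loss fstar p.2 :=
    L.measurable_loss.comp (measurable_const.prodMk measurable_snd)
  have h2 : Measurable fun p : F × Z => L.loss p.1 p.2 + -L.loss fstar p.2 :=
    L.measurable_loss.add h1.neg
  exact h2

lemma excessLoss_ne_bot (L : LearningProblem Z F) {fstar : F} {z : Z}
    (h : L.loss fstar z ≠ ⊤) (f : F) : L.excessLoss fstar f z ≠ ⊥ := by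
  rw [excessLoss, sub_eq_add_neg, EReal.add_ne_bot_iff]
  exact ⟨L.loss_ne_bot f z, by simpa using h⟩

lemma measurable_excessRisk (L : LearningProblem Z F) (fstar : F) :
    Measurable (L.excessRisk fstar) :=
  measurable_expect_kernel (κ := Kernel.const F L.P) (L.measurable_excessLoss fstar)

/-- The exponential factor `e^{-κ(ℓ_f - ℓ_{f*} + D)}`. -/
noncomputable def offsetExp (L : LearningProblem Z F) (fstar : F) (κ : ℝ) (D : Z → ℝ) (f : F)
    (z : Z) : ℝ :=
  negExp κ (L.excessLoss fstar f z) * Real.exp (-κ * D z)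

/-- An offset `D` of expectation at most `ε` turns `ℓ_{f*}` into a (pseudo-)loss `ℓ_{f*} - D` with
respect to which the `κ`-central condition holds without slack: all the `ℓ_f - ℓ_{f*} + D`, and
`D` itself, have exponential moment at most one at rate `-κ`. -/
structure IsOffset (L : LearningProblem Z F) (fstar : F) (κ ε : ℝ) (D : Z → ℝ) : Prop where
  loss_ne_top : ∀ᵐ z ∂L.P, L.loss fstar z ≠ ⊤
  measurable : Measurable D
  integrable : Integrable D L.P
  integral_le : ∫ z, D z ∂L.P ≤ ε
  lintegral_exp_le : ∫⁻ z, ENNReal.ofReal (Real.exp (-κ * D z)) ∂L.P ≤ 1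
  lintegral_offsetExp_le : ∀ f, ∫⁻ z, ENNReal.ofReal (L.offsetExp fstar κ D f z) ∂L.P ≤ 1

lemma offsetExp_nonneg (L : LearningProblem Z F) (fstar : F) (κ : ℝ) (D : Z → ℝ) (f : F) (z : Z) :
    0 ≤ L.offsetExp fstar κ D f z :=
  mul_nonneg (negExp_nonneg _ _) (Real.exp_pos _).le

lemma measurable_offsetExp (L : LearningProblem Z F) (fstar : F) (κ : ℝ) {D : Z → ℝ}
    (hD : Measurable D) : Measurable (Function.uncurry (L.offsetExp fstar κ D)) :=
  ((measurable_negExp κ).comp (L.measurable_excessLoss fstar)).mul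
    ((hD.comp measurable_snd).const_mul (-κ)).exp

lemma offsetExp_of_top (L : LearningProblem Z F) {fstar : F} {κ : ℝ} {D : Z → ℝ} {f : F} {z : Z}
    (h : L.excessLoss fstar f z = ⊤) : L.offsetExp fstar κ D f z = 0 := by
  simp [offsetExp, h]

lemma offsetExp_of_coe (L : LearningProblem Z F) {fstar : F} {κ : ℝ} {D : Z → ℝ} {f : F} {z : Z}
    {x : ℝ} (h : L.excessLoss fstar f z = (x : EReal)) :
    L.offsetExp fstar κ D f z = Real.exp (-κ * (x + D z)) := by
  rw [offsetExp, h, negExp_coe, ← Real.exp_add]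
  ring_nf

/-- The transfer step: the witness condition turns the exponential moments under an offset into
an upper bound on the excess risk, which in turn controls the exponential moment at the smaller
rate `η`.  In particular every excess risk is finite, and uniformly bounded. -/
lemma exists_excessRisk_eq {L : LearningProblem Z F} {fstar : F} {κ ε η u c C : ℝ} {D : Z → ℝ}
    (hD : L.IsOffset fstar κ ε D) (hw : L.Witness fstar u c) (hη : 0 < η) (h : η < κ)
    (hu : 0 ≤ u) (hc : 0 < c) (hC : 1 + 2 * η * u ≤ C * (1 - η / κ)) (f : F) :
    ∃ r : ℝ, L.excessRisk fstar f = (r : EReal) ∧ -ε ≤ r ∧ r ≤ C / (c * η) ∧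
      ∫⁻ z, ENNReal.ofReal (L.offsetExp fstar η D f z) ∂L.P ≤
        ENNReal.ofReal (Real.exp (-η * (c * r / C))) := by
  have hκ : 0 < κ := hη.trans h
  have hρ : 0 < 1 - η / κ := sub_pos.2 ((div_lt_one hκ).2 h)
  have hρ1 : 0 < η / κ := by positivity
  have hηu : 0 ≤ η * u := by positivity
  have hC0 : 0 < C := by
    by_contra hneg
    nlinarith
  have hC1 : 1 ≤ C := by nlinarith
  have hm : ∀ κ, Measurable (L.offsetExp fstar κ D f) := fun κ =>
    (L.measurable_offsetExp fstar κ hD.measurable).comp (measurable_const.prodMk measurable_id)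
  have hint : ∀ {g : Z → ℝ}, Measurable g → (∀ z, 0 ≤ g z) →
      ∫⁻ z, ENNReal.ofReal (g z) ∂L.P ≤ 1 → Integrable g L.P ∧ ∫ z, g z ∂L.P ≤ 1 := by
    intro g hg hnn hle
    have hi := (lintegral_ofReal_ne_top_iff_integrable hg.aestronglyMeasurable
      (Filter.Eventually.of_forall hnn)).1 (ne_top_of_le_ne_top ENNReal.one_ne_top hle)
    refine ⟨hi, ?_⟩
    rwa [← ofReal_integral_eq_lintegral_ofReal hi (Filter.Eventually.of_forall hnn),
      ENNReal.ofReal_le_one] at hle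
  obtain ⟨hiκ, hIκ⟩ := hint (hm κ) (L.offsetExp_nonneg fstar κ D f) (hD.lintegral_offsetExp_le f)
  obtain ⟨hiD, hID⟩ := hint ((hD.measurable.const_mul (-κ)).exp) (fun z => (Real.exp_pos _).le)
    hD.lintegral_exp_le
  have hcases : ∀ᵐ z ∂L.P, L.excessLoss fstar f z = ⊤ ∨
      ∃ x : ℝ, L.excessLoss fstar f z = (x : EReal) := by
    filter_upwards [hD.loss_ne_top] with z hz
    have := L.excessLoss_ne_bot hz f
    induction hx : L.excessLoss fstar f z with
    | bot => exact absurd hx this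
    | top => exact Or.inl rfl
    | coe x => exact Or.inr ⟨x, rfl⟩
  have hiη : Integrable (L.offsetExp fstar η D f) L.P := by
    refine ((integrable_const 1).add hiκ).mono' (hm η).aestronglyMeasurable ?_
    filter_upwards [hcases] with z hz
    rw [Real.norm_of_nonneg (L.offsetExp_nonneg _ _ _ _ _), Pi.add_apply]
    rcases hz with hz | ⟨x, hz⟩
    · rw [L.offsetExp_of_top hz, L.offsetExp_of_top hz]
      norm_num
    · rw [L.offsetExp_of_coe hz, L.offsetExp_of_coe hz]
      have := exp_mul_le_convex_comb hρ1.le (by linarith) (-κ * (x + D z))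
      rw [show η / κ * (-κ * (x + D z)) = -η * (x + D z) by field_simp] at this
      have := Real.exp_pos (-κ * (x + D z))
      nlinarith
  set E := ∫ z, L.offsetExp fstar η D f z ∂L.P with hE
  have hE0 : 0 ≤ E := integral_nonneg (L.offsetExp_nonneg fstar η D f)
  have hB1 : Integrable (fun z => C * ((1 - L.offsetExp fstar η D f z) / η)) L.P :=
    (((integrable_const 1).sub hiη).div_const η).const_mul C
  have hB2 : Integrable (fun z => (C - 1) * ((1 - L.offsetExp fstar κ D f z) / κ)) L.P :=
    (((integrable_const 1).sub hiκ).div_const κ).const_mul (C - 1)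
  have hB3 : Integrable (fun z => (1 - Real.exp (-κ * D z)) / κ) L.P :=
    ((integrable_const 1).sub hiD).div_const κ
  have hB12 : Integrable (fun z => C * ((1 - L.offsetExp fstar η D f z) / η) -
      (C - 1) * ((1 - L.offsetExp fstar κ D f z) / κ)) L.P := hB1.sub hB2
  have hone : ∀ {g : Z → ℝ} {d : ℝ}, Integrable g L.P →
      ∫ z, (1 - g z) / d ∂L.P = (1 - ∫ z, g z ∂L.P) / d := by
    intro g d hg
    rw [integral_div, integral_sub (integrable_const 1) hg]
    simp
  have hup : (c : EReal) * L.excessRisk fstar f ≤ ((C * ((1 - E) / η) : ℝ) : EReal) := by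
    refine (hw f).trans ((expect_le_integral (hB12.sub hB3) ?_).trans ?_)
    · filter_upwards [hcases] with z hz
      rw [Pi.sub_apply]
      rcases hz with hz | ⟨x, hz⟩
      · -- where the excess loss is infinite the truncation vanishes and the bound is its limit
        rw [L.offsetExp_of_top hz, L.offsetExp_of_top hz, hz, if_neg (by simp), ← EReal.coe_zero,
          EReal.coe_le_coe_iff]
        have h1 := expUtil_le_inv hκ (D z)
        have h2 := one_div_le_one_div_of_le hη h.le
        rw [expUtil] at h1
        simp only [sub_zero]
        nlinarith
      · rw [L.offsetExp_of_coe hz, L.offsetExp_of_coe hz, hz]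
        have := truncation_le_expUtil hη h hu hC x (D z)
        simp only [EReal.coe_le_coe_iff]
        split_ifs at this ⊢ with hxu
        · exact EReal.coe_le_coe_iff.2 this
        · exact EReal.coe_le_coe_iff.2 this
    · rw [EReal.coe_le_coe_iff, integral_sub' hB12 hB3, integral_sub hB1 hB2, integral_const_mul,
        integral_const_mul, hone hiη, hone hiκ, hone hiD]
      have h1 : 0 ≤ (C - 1) * ((1 - ∫ z, L.offsetExp fstar κ D f z ∂L.P) / κ) :=
        mul_nonneg (by linarith) (div_nonneg (by linarith) hκ.le)
      have h2 : 0 ≤ (1 - ∫ z, Real.exp (-κ * D z) ∂L.P) / κ := div_nonneg (by linarith) hκ.le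
      linarith
  have hlow : ((-ε : ℝ) : EReal) ≤ L.excessRisk fstar f := by
    have hB4 : Integrable (fun z => (1 - L.offsetExp fstar κ D f z) / κ) L.P :=
      ((integrable_const 1).sub hiκ).div_const κ
    refine le_trans ?_ (integral_le_expect (hB4.sub hD.integrable) ?_)
    · rw [EReal.coe_le_coe_iff, integral_sub' hB4 hD.integrable, hone hiκ]
      have := hD.integral_le
      have : 0 ≤ (1 - ∫ z, L.offsetExp fstar κ D f z ∂L.P) / κ := div_nonneg (by linarith) hκ.le
      linarith
    · filter_upwards [hcases] with z hz
      rcases hz with hz | ⟨x, hz⟩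
      · simp [hz]
      · rw [Pi.sub_apply, L.offsetExp_of_coe hz, hz, EReal.coe_le_coe_iff]
        have := expUtil_le_self hκ (x + D z)
        rw [expUtil] at this
        linarith
  induction hr : L.excessRisk fstar f with
  | bot => simp [hr] at hlow
  | top =>
    rw [hr, EReal.coe_mul_top_of_pos hc] at hup
    exact absurd (top_le_iff.1 hup) (EReal.coe_ne_top _)
  | coe r =>
    rw [hr, EReal.coe_le_coe_iff] at hlow
    rw [hr, ← EReal.coe_mul, EReal.coe_le_coe_iff] at hup
    have h1 : η * (c * r / C) ≤ 1 - E := by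
      rw [mul_div_assoc', div_le_iff₀ hC0]
      rw [mul_div_assoc', le_div_iff₀ hη] at hup
      linarith
    refine ⟨r, rfl, hlow, ?_, ?_⟩
    · rw [le_div_iff₀ (by positivity)]
      rw [mul_div_assoc', div_le_iff₀ hC0] at h1
      nlinarith
    · rw [← ofReal_integral_eq_lintegral_ofReal hiη
        (Filter.Eventually.of_forall (L.offsetExp_nonneg fstar η D f))]
      refine ENNReal.ofReal_le_ofReal ?_
      have := Real.add_one_le_exp (-η * (c * r / C))
      linarith

end LearningProblem
/-! ### The exponential inequality for the information complexity -/

namespace LearningProblem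

variable {Z F : Type*} [MeasurableSpace Z] [MeasurableSpace F]

lemma average_excessLoss_eq (L : LearningProblem Z F) {fstar : F} {n : ℕ} (hn : 1 ≤ n)
    {zs : Fin n → Z} (hzs : ∀ i, L.loss fstar (zs i) ≠ ⊤) (f : F) :
    ((1 / n : ℝ) : EReal) * ∑ i, L.excessLoss fstar f (zs i) = ⊤ ∨
      (∀ i, L.excessLoss fstar f (zs i) = ((L.excessLoss fstar f (zs i)).toReal : EReal)) ∧
      ((1 / n : ℝ) : EReal) * ∑ i, L.excessLoss fstar f (zs i) =
        ((1 / n * ∑ i, (L.excessLoss fstar f (zs i)).toReal : ℝ) : EReal) := by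
  have hn0 : (0 : ℝ) < 1 / n := by
    have : (0 : ℝ) < n := by exact_mod_cast hn
    positivity
  have hbot : ∀ i, L.excessLoss fstar f (zs i) ≠ ⊥ := fun i => L.excessLoss_ne_bot (hzs i) f
  by_cases h : ∃ i, L.excessLoss fstar f (zs i) = ⊤
  · obtain ⟨i, hi⟩ := h
    left
    rw [sum_eq_top Finset.univ (fun j _ => hbot j) (Finset.mem_univ i) hi,
      EReal.coe_mul_top_of_pos hn0]
  · push Not at h
    right
    have hcoe : ∀ i, L.excessLoss fstar f (zs i) =
        ((L.excessLoss fstar f (zs i)).toReal : EReal) := fun i =>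
      (EReal.coe_toReal (h i) (hbot i)).symm
    refine ⟨hcoe, ?_⟩
    rw [EReal.coe_mul, coe_sum_real]
    exact congrArg _ (Finset.sum_congr rfl fun i _ => hcoe i)

/-- Under an admissible distribution the average excess loss has an expectation above `-∞`. -/
lemma expect_average_excessLoss_ne_bot (L : LearningProblem Z F) {fstar : F} {n : ℕ}
    {zs : Fin n → Z} (hzs : ∀ i, L.loss fstar (zs i) ≠ ⊤) {Q : Measure F}
    (hQ : Q ∈ L.distributions) :
    expect Q (fun f => ((1 / n : ℝ) : EReal) * ∑ i, L.excessLoss fstar f (zs i)) ≠ ⊥ := by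
  have := hQ.1
  have hi : ∀ i, Integrable (fun f => -((-L.loss f (zs i)).toENNReal).toReal -
      (L.loss fstar (zs i)).toReal) Q := fun i => by
    have hm : Measurable fun f => (-L.loss f (zs i)).toENNReal :=
      (L.measurable_loss.comp (measurable_id.prodMk measurable_const)).neg.ereal_toENNReal
    exact (integrable_toReal_of_lintegral_ne_top hm.aemeasurable (hQ.2 (zs i)).ne).neg.sub
      (integrable_const _)
  have hg : Integrable (fun f => (1 / n : ℝ) * ∑ i, (-((-L.loss f (zs i)).toENNReal).toReal -
      (L.loss fstar (zs i)).toReal)) Q := (integrable_finsetSum _ fun i _ => hi i).const_mul _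
  have hle := integral_le_expect (U := fun f => ((1 / n : ℝ) : EReal) *
    ∑ i, L.excessLoss fstar f (zs i)) hg (Filter.Eventually.of_forall fun f => ?_)
  · exact ne_bot_of_le_ne_bot (EReal.coe_ne_bot _) hle
  · rw [EReal.coe_mul, coe_sum_real]
    refine mul_le_mul_of_nonneg_left (Finset.sum_le_sum fun i _ => ?_)
      (EReal.coe_nonneg.2 (by positivity))
    have h1 : L.loss fstar (zs i) = ((L.loss fstar (zs i)).toReal : EReal) :=
      (EReal.coe_toReal (hzs i) (L.loss_ne_bot _ _)).symm
    rw [EReal.coe_sub, excessLoss, ← h1]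
    refine EReal.sub_le_sub ?_ le_rfl
    induction hx : L.loss f (zs i) with
    | bot => exact absurd hx (L.loss_ne_bot _ _)
    | top => exact le_top
    | coe x =>
      rw [← EReal.coe_neg, EReal.real_coe_toENNReal, EReal.coe_le_coe_iff,
        ENNReal.toReal_ofReal']
      linarith [le_max_left (-x) 0]

end LearningProblem

namespace LearningAlgorithm

variable {Z F : Type*} [MeasurableSpace Z] [MeasurableSpace F] {L : LearningProblem Z F}

lemma isProbabilityMeasure_post (A : LearningAlgorithm L) (n : ℕ) (zs : Fin n → Z) :
    IsProbabilityMeasure (A.post n zs) := (A.post_mem n zs).1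

lemma isMarkovKernel_post (A : LearningAlgorithm L) (n : ℕ) : IsMarkovKernel (A.post n) :=
  ⟨A.isProbabilityMeasure_post n⟩

lemma isProbabilityMeasure_prior (A : LearningAlgorithm L) : IsProbabilityMeasure A.prior :=
  A.isProbabilityMeasure_post 0 _

lemma measurable_posteriorRisk (A : LearningAlgorithm L) (fstar : F) (n : ℕ) :
    Measurable (A.posteriorRisk fstar n) := by
  have := A.isMarkovKernel_post n
  exact measurable_expect_kernel (κ := A.post n) (U := fun _ => L.excessRisk fstar)
    ((L.measurable_excessRisk fstar).comp measurable_snd)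

lemma measurable_infoComplexity (A : LearningAlgorithm L) (fstar : F) (n : ℕ) (η : ℝ) :
    Measurable (A.infoComplexity fstar n η) := by
  have := A.isMarkovKernel_post n
  have h1 : Measurable (Function.uncurry fun (zs : Fin n → Z) f =>
      ((1 / n : ℝ) : EReal) * ∑ i, L.excessLoss fstar f (zs i)) := by
    refine Measurable.const_mul (Finset.measurable_sum _ fun i _ => ?_) _
    exact (L.measurable_excessLoss fstar).comp
      (measurable_snd.prodMk ((measurable_pi_apply i).comp measurable_fst))
  exact (measurable_expect_kernel (κ := A.post n) h1).add
    ((A.measurable_klDiv n).coe_ereal_ennreal.mul_const _)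

lemma infoComplexity_ne_bot (A : LearningAlgorithm L) {fstar : F} {n : ℕ} {η : ℝ}
    (hη : 0 < η) {zs : Fin n → Z} (hzs : ∀ i, L.loss fstar (zs i) ≠ ⊤) :
    A.infoComplexity fstar n η zs ≠ ⊥ := by
  rw [infoComplexity, EReal.add_ne_bot_iff]
  refine ⟨L.expect_average_excessLoss_ne_bot hzs (A.post_mem n zs), ?_⟩
  refine ne_bot_of_le_ne_bot EReal.zero_ne_bot (EReal.div_nonneg (EReal.coe_ennreal_nonneg _) ?_)
  exact EReal.coe_nonneg.2 (by positivity)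

/-- The weight `e^{ηn r(f)} ∏ᵢ e^{-η(L_f(zᵢ) + D(zᵢ))}` of a predictor `f` at the sample `zs`.  Its
expectation over an i.i.d. sample is at most one as soon as `E[e^{-η(L_f + D)}] ≤ e^{-η r(f)}`. -/
noncomputable def weight (L : LearningProblem Z F) (fstar : F) (η : ℝ) (D : Z → ℝ) (r : F → ℝ)
    (n : ℕ) (zs : Fin n → Z) (f : F) : ENNReal :=
  ENNReal.ofReal (Real.exp (η * n * r f)) *
    ∏ i, ENNReal.ofReal (L.offsetExp fstar η D f (zs i))

lemma measurable_weight (L : LearningProblem Z F) (fstar : F) (η : ℝ) {D : Z → ℝ}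
    (hD : Measurable D) {r : F → ℝ} (hr : Measurable r) (n : ℕ) :
    Measurable (Function.uncurry (weight L fstar η D r n)) := by
  refine ((hr.comp measurable_snd).const_mul (η * n)).exp.ennreal_ofReal.mul
    (Finset.measurable_prod _ fun i _ => ?_)
  exact ((L.measurable_offsetExp fstar η hD).comp
    (measurable_snd.prodMk ((measurable_pi_apply i).comp measurable_fst))).ennreal_ofReal

lemma lintegral_weight_le {fstar : F} {η : ℝ} {D : Z → ℝ} (hD : Measurable D) {r : F → ℝ}
    {f : F} (hf : ∫⁻ z, ENNReal.ofReal (L.offsetExp fstar η D f z) ∂L.P ≤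
      ENNReal.ofReal (Real.exp (-η * r f))) (n : ℕ) :
    ∫⁻ zs, weight L fstar η D r n zs f ∂(Measure.pi fun _ : Fin n => L.P) ≤ 1 := by
  unfold weight
  have hm : Measurable fun z => ENNReal.ofReal (L.offsetExp fstar η D f z) :=
    ((L.measurable_offsetExp fstar η hD).comp
      (measurable_const.prodMk measurable_id)).ennreal_ofReal
  rw [lintegral_const_mul' _ _ ENNReal.ofReal_ne_top, lintegral_pi_prod L.P n hm]
  calc ENNReal.ofReal (Real.exp (η * n * r f)) *
        (∫⁻ z, ENNReal.ofReal (L.offsetExp fstar η D f z) ∂L.P) ^ n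
      ≤ ENNReal.ofReal (Real.exp (η * n * r f)) * ENNReal.ofReal (Real.exp (-η * r f)) ^ n := by
        gcongr
    _ = 1 := by
        rw [← ENNReal.ofReal_pow (Real.exp_pos _).le, ← Real.exp_nat_mul,
          ← ENNReal.ofReal_mul (Real.exp_pos _).le, ← Real.exp_add]
        ring_nf
        simp

/-- The information-theoretic step, at a fixed sample: the posterior enters the left-hand side
only, the prior the right-hand side only. -/
lemma exp_sub_infoComplexity_le (A : LearningAlgorithm L) {fstar : F} {n : ℕ} (hn : 1 ≤ n)
    {η : ℝ} (hη : 0 < η) {D : Z → ℝ} (hD : Measurable D) {r : F → ℝ} (hr : Measurable r)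
    {zs : Fin n → Z} (hzs : ∀ i, L.loss fstar (zs i) ≠ ⊤)
    (hri : Integrable r (A.post n zs)) :
    EReal.exp (((η * n : ℝ) : EReal) *
        (((∫ f, r f ∂A.post n zs - 1 / n * ∑ i, D (zs i) : ℝ) : EReal) -
          A.infoComplexity fstar n η zs)) ≤
      ∫⁻ f, weight L fstar η D r n zs f ∂A.prior := by
  have := A.isProbabilityMeasure_post n zs
  have := A.isProbabilityMeasure_prior
  have hn0 : (0 : ℝ) < n := by exact_mod_cast hn
  have hηn : 0 < η * n := by positivity
  have htopcase : A.infoComplexity fstar n η zs = ⊤ → EReal.exp (((η * n : ℝ) : EReal) *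
        (((∫ f, r f ∂A.post n zs - 1 / n * ∑ i, D (zs i) : ℝ) : EReal) -
          A.infoComplexity fstar n η zs)) ≤
      ∫⁻ f, weight L fstar η D r n zs f ∂A.prior := by
    intro h
    rw [h, EReal.sub_top, EReal.coe_mul_bot_of_pos hηn]
    simp
  set S : F → EReal := fun f => ((1 / n : ℝ) : EReal) * ∑ i, L.excessLoss fstar f (zs i) with hS
  have hSbot : expect (A.post n zs) S ≠ ⊥ :=
    L.expect_average_excessLoss_ne_bot hzs (A.post_mem n zs)
  have hklnn : (0 : EReal) ≤ (InformationTheory.klDiv (A.post n zs) A.prior : EReal) /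
      ((η * n : ℝ) : EReal) :=
    EReal.div_nonneg (EReal.coe_ennreal_nonneg _) (EReal.coe_nonneg.2 hηn.le)
  by_cases hStop : expect (A.post n zs) S = ⊤
  · refine htopcase ?_
    rw [infoComplexity, hStop]
    exact EReal.top_add_of_ne_bot (ne_bot_of_le_ne_bot EReal.zero_ne_bot hklnn)
  by_cases hkl : InformationTheory.klDiv (A.post n zs) A.prior = ⊤
  · refine htopcase ?_
    rw [infoComplexity, hkl, EReal.coe_ennreal_top, EReal.top_div_of_pos_ne_top
      (EReal.coe_pos.2 hηn) (EReal.coe_ne_top _)]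
    exact EReal.add_top_of_ne_bot hSbot
  have hSm : Measurable S := by
    refine Measurable.const_mul (Finset.measurable_sum _ fun i _ => ?_) _
    exact (L.measurable_excessLoss fstar).comp (measurable_id.prodMk measurable_const)
  obtain ⟨hSi, hSae, hSeq⟩ := integrable_of_expect hSm.aemeasurable hSbot hStop
  have hIC : A.infoComplexity fstar n η zs = ((∫ f, (S f).toReal ∂A.post n zs +
      (InformationTheory.klDiv (A.post n zs) A.prior).toReal / (η * n) : ℝ) : EReal) := by
    rw [infoComplexity, EReal.coe_add, ← hSeq,
      EReal.coe_div (InformationTheory.klDiv (A.post n zs) A.prior).toReal,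
      EReal.coe_ennreal_toReal hkl]
  set d := 1 / n * ∑ i, D (zs i) with hd
  have hgi : Integrable (fun f => η * n * (r f - d - (S f).toReal)) (A.post n zs) :=
    ((hri.sub (integrable_const d)).sub hSi).const_mul _
  have hW : ∀ᵐ f ∂A.post n zs, ENNReal.ofReal (Real.exp (η * n * (r f - d - (S f).toReal))) ≤
      weight L fstar η D r n zs f := by
    filter_upwards [hSae] with f hf
    rcases L.average_excessLoss_eq hn hzs f with h | ⟨hcoe, h⟩
    · rw [show S f = ⊤ from h] at hf
      exact absurd hf (by simp)
    · rw [weight, ← ENNReal.ofReal_prod_of_nonneg fun i _ => L.offsetExp_nonneg _ _ _ _ _,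
        ← ENNReal.ofReal_mul (Real.exp_pos _).le,
        Finset.prod_congr rfl fun i _ => L.offsetExp_of_coe (hcoe i), ← Real.exp_sum,
        ← Real.exp_add, show (S f).toReal = _ from congrArg EReal.toReal h, EReal.toReal_coe]
      refine le_of_eq ?_
      congr 2
      rw [← Finset.mul_sum, Finset.sum_add_distrib, hd]
      field_simp
      ring
  refine le_trans (le_of_eq ?_) (ofReal_exp_integral_sub_klDiv_le hkl hgi
    ((measurable_weight L fstar η hD hr n).comp (measurable_const.prodMk measurable_id)) hW)
  have hri' : Integrable (fun f => r f - d) (A.post n zs) := hri.sub (integrable_const d)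
  rw [hIC, ← EReal.coe_sub, ← EReal.coe_mul, EReal.exp_coe, integral_const_mul,
    integral_sub hri' hSi, integral_sub hri (integrable_const d)]
  simp only [integral_const, probReal_univ, one_smul]
  congr 2
  field_simp
  ring

lemma ae_all_loss_ne_top {fstar : F} (hfin : ∀ᵐ z ∂L.P, L.loss fstar z ≠ ⊤) (n : ℕ) :
    ∀ᵐ zs ∂(Measure.pi fun _ : Fin n => L.P), ∀ i, L.loss fstar (zs i) ≠ ⊤ :=
  ae_all_iff.2 fun i => (Measure.quasiMeasurePreserving_eval (fun _ : Fin n => L.P) i).ae hfin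

/-- The exponential inequality from which both bounds follow: averaging the fixed-sample
inequality over the sample and exchanging the order of integration. -/
lemma lintegral_exp_sub_infoComplexity_le (A : LearningAlgorithm L) {fstar : F} {n : ℕ}
    (hn : 1 ≤ n) {η : ℝ} (hη : 0 < η) {D : Z → ℝ} (hD : Measurable D) {r : F → ℝ}
    (hr : Measurable r) (hfin : ∀ᵐ z ∂L.P, L.loss fstar z ≠ ⊤)
    (hri : ∀ zs, Integrable r (A.post n zs))
    (hf : ∀ f, ∫⁻ z, ENNReal.ofReal (L.offsetExp fstar η D f z) ∂L.P ≤
      ENNReal.ofReal (Real.exp (-η * r f))) :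
    ∫⁻ zs, EReal.exp (((η * n : ℝ) : EReal) *
        (((∫ f, r f ∂A.post n zs - 1 / n * ∑ i, D (zs i) : ℝ) : EReal) -
          A.infoComplexity fstar n η zs)) ∂(Measure.pi fun _ : Fin n => L.P) ≤ 1 := by
  have := A.isProbabilityMeasure_prior
  calc _ ≤ ∫⁻ zs, ∫⁻ f, weight L fstar η D r n zs f ∂A.prior
          ∂(Measure.pi fun _ : Fin n => L.P) := by
        refine lintegral_mono_ae ?_
        filter_upwards [ae_all_loss_ne_top hfin n] with zs hzs
        exact A.exp_sub_infoComplexity_le hn hη hD hr hzs (hri zs)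
    _ = ∫⁻ f, ∫⁻ zs, weight L fstar η D r n zs f ∂(Measure.pi fun _ : Fin n => L.P)
          ∂A.prior :=
        lintegral_lintegral_swap (measurable_weight L fstar η hD hr n).aemeasurable
    _ ≤ ∫⁻ _, 1 ∂A.prior := lintegral_mono fun f => lintegral_weight_le hD (hf f) n
    _ = 1 := by simp

end LearningAlgorithm
/-! ### Offsets from the central and the PPC condition -/

namespace LearningProblem

variable {Z F : Type*} [MeasurableSpace Z] [MeasurableSpace F]

lemma measurable_loss_left (L : LearningProblem Z F) (f : F) : Measurable (L.loss f) :=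
  L.measurable_loss.comp (measurable_const.prodMk measurable_id)

lemma measurable_loss_right (L : LearningProblem Z F) (z : Z) : Measurable fun f => L.loss f z :=
  L.measurable_loss.comp (measurable_id.prodMk measurable_const)

lemma expect_loss_ne_bot (L : LearningProblem Z F) (f : F) : expect L.P (L.loss f) ≠ ⊥ := by
  rw [expect, sub_eq_add_neg, EReal.add_ne_bot_iff]
  refine ⟨EReal.coe_ennreal_ne_bot _, ?_⟩
  simpa using (L.negPart_lt_top f).ne

lemma integrable_loss (L : LearningProblem Z F) {f : F} (h : expect L.P (L.loss f) ≠ ⊤) :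
    Integrable (fun z => (L.loss f z).toReal) L.P ∧
      (∀ᵐ z ∂L.P, L.loss f z = ((L.loss f z).toReal : EReal)) ∧
      expect L.P (L.loss f) = ((∫ z, (L.loss f z).toReal ∂L.P : ℝ) : EReal) :=
  integrable_of_expect (L.measurable_loss_left f).aemeasurable (L.expect_loss_ne_bot f) h

/-- Under the central condition up to `ε` the constant `ε` is an offset. -/
lemma CentralUpTo.isOffset {L : LearningProblem Z F} {fstar : F} {κ ε : ℝ}
    (h : L.CentralUpTo fstar κ ε) (hκ : 0 < κ) (hε : 0 ≤ ε) :
    L.IsOffset fstar κ ε (fun _ => ε) := by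
  have hfin : ∀ᵐ z ∂L.P, L.loss fstar z ≠ ⊤ := by
    obtain ⟨f, hf⟩ := L.nontrivial
    have hm : Measurable fun z => EReal.exp ((κ : EReal) *
        ((L.loss fstar z + -L.loss f z) + -(ε : EReal))) :=
      (((((L.measurable_loss_left fstar).add (L.measurable_loss_left f).neg).add_const _).const_mul
        _)).ereal_exp
    have hlt := ae_lt_top hm (ne_top_of_le_ne_top ENNReal.one_ne_top (h f))
    filter_upwards [hlt, (L.integrable_loss hf.ne).2.1] with z h1 h2 h3
    rw [h2, h3, ← EReal.coe_neg, ← EReal.coe_neg, EReal.top_add_coe, EReal.top_add_coe,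
      EReal.coe_mul_top_of_pos hκ] at h1
    simp at h1
  refine ⟨hfin, measurable_const, integrable_const _, by simp, ?_, fun f => ?_⟩
  · rw [lintegral_const, measure_univ, mul_one, ENNReal.ofReal_le_one, Real.exp_le_one_iff]
    nlinarith
  · refine le_trans (le_of_eq (lintegral_congr_ae ?_)) (h f)
    filter_upwards [hfin] with z hz
    have h1 : L.loss fstar z = ((L.loss fstar z).toReal : EReal) :=
      (EReal.coe_toReal hz (L.loss_ne_bot _ _)).symm
    induction hx : L.loss f z with
    | bot => exact absurd hx (L.loss_ne_bot _ _)
    | top =>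
      have h2 : L.excessLoss fstar f z = ⊤ := by
        rw [excessLoss, hx, h1, EReal.top_sub_coe]
      rw [L.offsetExp_of_top h2, EReal.sub_top, EReal.bot_sub, EReal.coe_mul_bot_of_pos hκ]
      simp
    | coe x =>
      have h2 : L.excessLoss fstar f z = ((x - (L.loss fstar z).toReal : ℝ) : EReal) := by
        rw [excessLoss, hx, EReal.coe_sub, ← h1]
      rw [L.offsetExp_of_coe h2, h1, ← EReal.coe_sub, ← EReal.coe_sub, ← EReal.coe_mul,
        EReal.exp_coe, EReal.toReal_coe]
      ring_nf

lemma dirac_mem_distributions (L : LearningProblem Z F) (f : F) :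
    Measure.dirac f ∈ L.distributions := by
  refine ⟨inferInstance, fun z => ?_⟩
  have hm : Measurable fun g => (-L.loss g z).toENNReal :=
    (L.measurable_loss_right z).neg.ereal_toENNReal
  rw [lintegral_dirac' f hm, lt_top_iff_ne_top,
    EReal.toENNReal_ne_top_iff]
  simpa using L.loss_ne_bot f z

lemma convexComb_mem_distributions (L : LearningProblem Z F) {Q R : Measure F}
    (hQ : Q ∈ L.distributions) (hR : R ∈ L.distributions) {a b : ENNReal} (hab : a + b = 1) :
    a • Q + b • R ∈ L.distributions := by
  have := hQ.1
  have := hR.1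
  have ha : a ≠ ⊤ := ne_top_of_le_ne_top ENNReal.one_ne_top (hab ▸ le_self_add)
  have hb : b ≠ ⊤ := ne_top_of_le_ne_top ENNReal.one_ne_top (hab ▸ le_add_self)
  refine ⟨⟨by simp [hab]⟩, fun z => ?_⟩
  rw [lintegral_add_measure, lintegral_smul_measure, lintegral_smul_measure]
  exact ENNReal.add_lt_top.2 ⟨ENNReal.mul_lt_top ha.lt_top (hQ.2 z),
    ENNReal.mul_lt_top hb.lt_top (hR.2 z)⟩

lemma lintegral_exp_dirac (L : LearningProblem Z F) (κ : ℝ) (f : F) (z : Z) :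
    ∫⁻ g, EReal.exp (((-κ : ℝ) : EReal) * L.loss g z) ∂(Measure.dirac f) =
      EReal.exp (((-κ : ℝ) : EReal) * L.loss f z) :=
  lintegral_dirac' f ((L.measurable_loss_right z).const_mul _).ereal_exp

lemma mixLoss_dirac (L : LearningProblem Z F) {κ : ℝ} (hκ : 0 < κ) (f : F) :
    L.mixLoss κ (Measure.dirac f) = L.loss f := by
  funext z
  rw [mixLoss, lintegral_exp_dirac, EReal.log_exp]
  induction hx : L.loss f z with
  | bot => exact absurd hx (L.loss_ne_bot f z)
  | top =>
    rw [EReal.coe_mul_top_of_neg (by linarith), EReal.coe_mul_bot_of_neg (by simpa using hκ)]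
  | coe x =>
    rw [← EReal.coe_mul, ← EReal.coe_mul, EReal.coe_eq_coe_iff]
    field_simp

/-- The mixture likelihoods `E_{f ∼ Q}[e^{-κℓ_f}]` relative to `e^{-κℓ_{f*}}`, as everywhere
finite measurable functions. -/
def mixtureRatios (L : LearningProblem Z F) (fstar : F) (κ : ℝ) : Set (Z → ℝ) :=
  {r | Measurable r ∧ (∀ z, 0 ≤ r z) ∧ ∃ Q ∈ L.distributions, ∀ᵐ z ∂L.P,
    ∫⁻ f, EReal.exp (((-κ : ℝ) : EReal) * L.loss f z) ∂Q =
      ENNReal.ofReal (r z * Real.exp (-κ * (L.loss fstar z).toReal))}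

lemma convex_mixtureRatios (L : LearningProblem Z F) (fstar : F) (κ : ℝ) :
    Convex ℝ (L.mixtureRatios fstar κ) := by
  rintro r ⟨hr, hr0, Q, hQ, hrQ⟩ s ⟨hs, hs0, R, hR, hsR⟩ a b ha hb hab
  refine ⟨(hr.const_smul a).add (hs.const_smul b), fun z => ?_,
    ENNReal.ofReal a • Q + ENNReal.ofReal b • R,
    L.convexComb_mem_distributions hQ hR ?_, ?_⟩
  · exact add_nonneg (mul_nonneg ha (hr0 z)) (mul_nonneg hb (hs0 z))
  · rw [← ENNReal.ofReal_add ha hb, hab, ENNReal.ofReal_one]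
  · filter_upwards [hrQ, hsR] with z h1 h2
    have e1 := mul_nonneg (hr0 z) (Real.exp_pos (-κ * (L.loss fstar z).toReal)).le
    have e2 := mul_nonneg (hs0 z) (Real.exp_pos (-κ * (L.loss fstar z).toReal)).le
    rw [lintegral_add_measure, lintegral_smul_measure, lintegral_smul_measure, h1, h2,
      smul_eq_mul, smul_eq_mul, ← ENNReal.ofReal_mul ha, ← ENNReal.ofReal_mul hb,
      ← ENNReal.ofReal_add (mul_nonneg ha e1) (mul_nonneg hb e2)]
    simp only [Pi.add_apply, Pi.smul_apply, smul_eq_mul]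
    ring_nf

lemma negExp_mem_mixtureRatios (L : LearningProblem Z F) {fstar : F} {κ : ℝ} (hκ : 0 < κ)
    (hfin : ∀ᵐ z ∂L.P, L.loss fstar z = ((L.loss fstar z).toReal : EReal)) (f : F) :
    (fun z => negExp κ (L.excessLoss fstar f z)) ∈ L.mixtureRatios fstar κ := by
  refine ⟨(measurable_negExp κ).comp ((L.measurable_excessLoss fstar).comp
    (measurable_const.prodMk measurable_id)), fun z => negExp_nonneg _ _, Measure.dirac f,
    L.dirac_mem_distributions f, ?_⟩
  filter_upwards [hfin] with z h1
  rw [lintegral_exp_dirac]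
  induction hx : L.loss f z with
  | bot => exact absurd hx (L.loss_ne_bot f z)
  | top =>
    rw [EReal.coe_mul_top_of_neg (by linarith), excessLoss, hx, h1, EReal.top_sub_coe]
    simp
  | coe x =>
    have h2 : L.excessLoss fstar f z = ((x - (L.loss fstar z).toReal : ℝ) : EReal) := by
      rw [excessLoss, hx, EReal.coe_sub, ← h1]
    rw [h2, negExp_coe, ← Real.exp_add, ← EReal.coe_mul, EReal.exp_coe]
    ring_nf

lemma one_mem_mixtureRatios (L : LearningProblem Z F) {fstar : F} {κ : ℝ}
    (hfin : ∀ᵐ z ∂L.P, L.loss fstar z = ((L.loss fstar z).toReal : EReal)) :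
    (fun _ => 1) ∈ L.mixtureRatios fstar κ := by
  refine ⟨measurable_const, fun _ => zero_le_one, Measure.dirac fstar,
    L.dirac_mem_distributions fstar, ?_⟩
  filter_upwards [hfin] with z h1
  rw [lintegral_exp_dirac, h1, ← EReal.coe_mul, EReal.exp_coe, EReal.toReal_coe, one_mul]

/-- The PPC condition bounds the expected logarithms of the mixture ratios. -/
lemma integral_log_mixtureRatio_le (L : LearningProblem Z F) {fstar : F} {κ ε : ℝ} (hκ : 0 < κ)
    (hstar : expect L.P (L.loss fstar) ≠ ⊤)
    (hppc : ∀ Q ∈ L.distributions,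
      expect L.P (L.loss fstar) ≤ (ε : EReal) + expect L.P (L.mixLoss κ Q))
    {r : Z → ℝ} (hr : r ∈ L.mixtureRatios fstar κ) {δ : ℝ} (hδ : 0 < δ) (hrδ : ∀ z, δ ≤ r z) :
    Integrable (fun z => Real.log (r z)) L.P ∧ ∫ z, Real.log (r z) ∂L.P ≤ κ * ε := by
  obtain ⟨hrm, -, Q, hQ, hrQ⟩ := hr
  obtain ⟨hi, -, hE⟩ := L.integrable_loss hstar
  set l : Z → ℝ := fun z => (L.loss fstar z).toReal with hl
  have hpos : ∀ z, 0 < r z := fun z => hδ.trans_le (hrδ z)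
  have hmix : ∀ᵐ z ∂L.P, L.mixLoss κ Q z = ((l z - Real.log (r z) / κ : ℝ) : EReal) := by
    filter_upwards [hrQ] with z hz
    have h1 : 0 < r z * Real.exp (-κ * l z) := mul_pos (hpos z) (Real.exp_pos _)
    rw [mixLoss, hz, ENNReal.log_ofReal_of_pos h1, ← EReal.coe_mul, EReal.coe_eq_coe_iff,
      Real.log_mul (hpos z).ne' (Real.exp_pos _).ne', Real.log_exp]
    field_simp
    ring
  have hQE := hppc Q hQ
  rw [expect_congr_ae hmix] at hQE
  set m : Z → EReal := fun z => ((l z - Real.log (r z) / κ : ℝ) : EReal) with hm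
  have hmm : Measurable m :=
    ((L.measurable_loss_left fstar).ereal_toReal.sub (hrm.log.div_const κ)).coe_real_ereal
  have htop : expect L.P m ≠ ⊤ := by
    have := expect_le_integral (U := m) (hi.sub (integrable_const (Real.log δ / κ)))
      (Filter.Eventually.of_forall fun z => by
        have := Real.log_le_log hδ (hrδ z)
        rw [hm, Pi.sub_apply, EReal.coe_le_coe_iff]
        gcongr)
    exact ne_top_of_le_ne_top (EReal.coe_ne_top _) this
  have hbot : expect L.P m ≠ ⊥ := by
    intro h
    rw [h, EReal.add_bot, hE] at hQE
    exact EReal.coe_ne_bot _ (le_bot_iff.1 hQE)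
  obtain ⟨hmi, -, hmE⟩ := integrable_of_expect hmm.aemeasurable hbot htop
  simp only [hm, EReal.toReal_coe] at hmi
  have hlog : Integrable (fun z => Real.log (r z)) L.P := by
    refine ((hi.sub hmi).const_mul κ).congr (Filter.Eventually.of_forall fun z => ?_)
    simp only [Pi.sub_apply, hl]
    field_simp
    ring
  refine ⟨hlog, ?_⟩
  rw [hmE, hE, ← EReal.coe_add, EReal.coe_le_coe_iff] at hQE
  simp only [hm, EReal.toReal_coe] at hQE
  rw [integral_sub hi (hlog.div_const κ), integral_div] at hQE
  have : (∫ z, Real.log (r z) ∂L.P) / κ ≤ ε := by linarith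
  rwa [div_le_iff₀' hκ] at this

/-- Under the PPC condition an offset exists: the regret `ℓ_{f*} - ℓ_g` of `f*` against the
pseudo-predictor `g` given by the reversed information projection. -/
lemma exists_isOffset_of_ppc (L : LearningProblem Z F) {fstar : F} {κ ε : ℝ} (hκ : 0 < κ)
    (hppc : expect L.P (L.loss fstar) - (⨅ Q ∈ L.distributions, expect L.P (L.mixLoss κ Q))
      ≤ (ε : EReal)) :
    ∃ D, L.IsOffset fstar κ ε D := by
  set I := ⨅ Q ∈ L.distributions, expect L.P (L.mixLoss κ Q) with hI
  have hIle : ∀ Q ∈ L.distributions, I ≤ expect L.P (L.mixLoss κ Q) := fun Q hQ =>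
    iInf₂_le Q hQ
  have hstar : expect L.P (L.loss fstar) ≠ ⊤ := by
    obtain ⟨f, hf⟩ := L.nontrivial
    have h1 := hIle _ (L.dirac_mem_distributions f)
    rw [L.mixLoss_dirac hκ] at h1
    intro h
    have h2 : I ≠ ⊤ := (h1.trans_lt hf).ne
    rw [h, EReal.top_sub h2] at hppc
    exact EReal.coe_ne_top _ (top_le_iff.1 hppc)
  have hadd : expect L.P (L.loss fstar) ≤ (ε : EReal) + I :=
    (EReal.sub_le_iff_le_add (Or.inr (EReal.coe_ne_top _)) (Or.inr (EReal.coe_ne_bot _))).1 hppc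
  obtain ⟨-, hfin, -⟩ := L.integrable_loss hstar
  obtain ⟨G, hG, hGpos, hlogG, hlogGle, hGE⟩ :=
    exists_reversed_projection (P := L.P) (L.convex_mixtureRatios fstar κ)
      (L.one_mem_mixtureRatios hfin) (fun r hr => hr.1) (fun r hr => hr.2.1) (b := κ * ε)
      (fun r hr δ hδ hrδ => L.integral_log_mixtureRatio_le hκ hstar
        (fun Q hQ => hadd.trans (add_le_add le_rfl (hIle Q hQ))) hr hδ hrδ)
  have hexp : ∀ z, Real.exp (-κ * (Real.log (G z) / κ)) = 1 / G z := by
    intro z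
    rw [show -κ * (Real.log (G z) / κ) = -Real.log (G z) by field_simp, Real.exp_neg,
      Real.exp_log (hGpos z), one_div]
  refine ⟨fun z => Real.log (G z) / κ, ?_, hG.log.div_const κ, hlogG.div_const κ, ?_, ?_,
    fun f => ?_⟩
  · filter_upwards [hfin] with z hz
    rw [hz]
    exact EReal.coe_ne_top _
  · rw [integral_div, div_le_iff₀' hκ]
    exact hlogGle
  · simp_rw [hexp]
    exact hGE _ (L.one_mem_mixtureRatios hfin)
  · simp_rw [offsetExp, hexp, mul_one_div]
    exact hGE _ (L.negExp_mem_mixtureRatios hκ hfin f)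

end LearningProblem
/-! ### Excess risk bounds -/

lemma integral_average {Z : Type*} [MeasurableSpace Z] {P : Measure Z} [IsProbabilityMeasure P]
    {n : ℕ} (hn : 1 ≤ n) {D : Z → ℝ} (hD : Integrable D P) :
    Integrable (fun zs : Fin n → Z => 1 / (n : ℝ) * ∑ i, D (zs i)) (Measure.pi fun _ => P) ∧
      ∫ zs, 1 / (n : ℝ) * ∑ i, D (zs i) ∂(Measure.pi fun _ : Fin n => P) = ∫ z, D z ∂P := by
  have hn0 : (n : ℝ) ≠ 0 := by positivity
  have hi : ∀ i : Fin n, Integrable (fun zs : Fin n → Z => D (zs i)) (Measure.pi fun _ => P) :=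
    fun i => integrable_comp_eval (μ := fun _ : Fin n => P) (i := i) hD
  refine ⟨(integrable_finsetSum _ fun i _ => hi i).const_mul _, ?_⟩
  rw [integral_const_mul, integral_finsetSum _ fun i _ => hi i]
  have he : ∀ i : Fin n, ∫ zs, D (zs i) ∂(Measure.pi fun _ : Fin n => P) = ∫ z, D z ∂P :=
    fun i => integral_comp_eval (μ := fun _ : Fin n => P) (i := i) hD.aestronglyMeasurable
  simp only [he, Finset.sum_const, Finset.card_univ, Fintype.card_fin, nsmul_eq_mul]
  field_simp

section Bounds

variable {Z F : Type*} [MeasurableSpace Z] [MeasurableSpace F] {L : LearningProblem Z F}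

/-- The posterior excess risk is real-valued and bounded, and satisfies the exponential inequality
with respect to the information complexity and the averaged offset. -/
lemma LearningAlgorithm.exists_posteriorRisk_eq (A : LearningAlgorithm L) {fstar : F}
    {κ ε η u c C : ℝ} {D : Z → ℝ} (hD : L.IsOffset fstar κ ε D) (hw : L.Witness fstar u c)
    (hη : 0 < η) (h : η < κ) (hu : 0 ≤ u) (hc : 0 < c)
    (hC : 1 + 2 * η * u ≤ C * (1 - η / κ)) {n : ℕ} (hn : 1 ≤ n) :
    ∃ ρ : (Fin n → Z) → ℝ, (∀ zs, A.posteriorRisk fstar n zs = (ρ zs : EReal)) ∧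
      Integrable ρ (Measure.pi fun _ => L.P) ∧
      ∫⁻ zs, EReal.exp (((η * n : ℝ) : EReal) *
        (((ρ zs / (C / c) - 1 / n * ∑ i, D (zs i) : ℝ) : EReal) -
          A.infoComplexity fstar n η zs)) ∂(Measure.pi fun _ : Fin n => L.P) ≤ 1 := by
  choose r hr hlow hup hexp using
    LearningProblem.exists_excessRisk_eq hD hw hη h hu hc hC
  have hrm : Measurable r := by
    have : r = fun f => (L.excessRisk fstar f).toReal := by
      funext f
      rw [hr, EReal.toReal_coe]
    rw [this]
    exact (L.measurable_excessRisk fstar).ereal_toReal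
  have hbd : ∀ f, ‖r f‖ ≤ |ε| + |C / (c * η)| := fun f => by
    rw [Real.norm_eq_abs, abs_le]
    have h1 := le_abs_self ε
    have h2 := le_abs_self (C / (c * η))
    have h3 := abs_nonneg ε
    have h4 := abs_nonneg (C / (c * η))
    have h5 := hlow f
    have h6 := hup f
    constructor <;> linarith
  have hprob := A.isProbabilityMeasure_post n
  have hri : ∀ zs, Integrable r (A.post n zs) := fun zs =>
    Integrable.of_bound hrm.aestronglyMeasurable _ (Filter.Eventually.of_forall hbd)
  have hρ : ∀ zs, A.posteriorRisk fstar n zs = ((∫ f, r f ∂A.post n zs : ℝ) : EReal) :=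
    fun zs => by
      rw [posteriorRisk, show L.excessRisk fstar = fun f => (r f : EReal) from funext hr,
        expect_coe (hri zs)]
  refine ⟨fun zs => ∫ f, r f ∂A.post n zs, hρ, ?_, ?_⟩
  · have hm : Measurable fun zs => ∫ f, r f ∂A.post n zs := by
      have : (fun zs => ∫ f, r f ∂A.post n zs) =
          fun zs => (A.posteriorRisk fstar n zs).toReal := by
        funext zs
        rw [hρ, EReal.toReal_coe]
      rw [this]
      exact (A.measurable_posteriorRisk fstar n).ereal_toReal
    refine Integrable.of_bound hm.aestronglyMeasurable (|ε| + |C / (c * η)|)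
      (Filter.Eventually.of_forall fun zs => ?_)
    simpa using norm_integral_le_of_norm_le_const (μ := A.post n zs)
      (Filter.Eventually.of_forall hbd)
  · have := A.lintegral_exp_sub_infoComplexity_le hn hη hD.measurable
      (r := fun f => r f / (C / c)) (hrm.div_const _) hD.loss_ne_top
      (fun zs => (hri zs).div_const _) (fun f => by
        have := hexp f
        rwa [show c * r f / C = r f / (C / c) by rw [div_div_eq_mul_div, mul_comm]] at this)
    simpa only [integral_div] using this

/-- The exponential stochastic inequality obtained from a constant offset. -/
lemma LearningAlgorithm.esi_posteriorRisk (A : LearningAlgorithm L) {fstar : F}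
    {κ ε η u c C : ℝ} (hD : L.IsOffset fstar κ ε fun _ => ε) (hw : L.Witness fstar u c)
    (hη : 0 < η) (h : η < κ) (hu : 0 ≤ u) (hc : 0 < c) (hC0 : 0 < C)
    (hC : 1 + 2 * η * u ≤ C * (1 - η / κ)) {n : ℕ} (hn : 1 ≤ n) :
    ESI (Measure.pi fun _ : Fin n => L.P) (η * n / (2 * (C / c))) (A.posteriorRisk fstar n)
      (fun zs => ((C / c : ℝ) : EReal) * (A.infoComplexity fstar n η zs + (ε : EReal))) := by
  have hn0 : (0 : ℝ) < n := by exact_mod_cast hn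
  have hc' : 0 < C / c := by positivity
  obtain ⟨ρ, hρ, -, hexp⟩ := A.exists_posteriorRisk_eq hD hw hη h hu hc hC hn
  rw [ESI]
  calc _ ≤ ∫⁻ zs, (ENNReal.ofReal (1 / 2) + ENNReal.ofReal (1 / 2) *
        EReal.exp (((η * n : ℝ) : EReal) *
        (((ρ zs / (C / c) - 1 / n * ∑ _i : Fin n, ε : ℝ) : EReal) -
          A.infoComplexity fstar n η zs))) ∂(Measure.pi fun _ : Fin n => L.P) := by
        refine lintegral_mono_ae ?_
        filter_upwards [LearningAlgorithm.ae_all_loss_ne_top hD.loss_ne_top n] with zs hzs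
        have hbot := A.infoComplexity_ne_bot hη hzs
        rw [hρ]
        induction hx : A.infoComplexity fstar n η zs with
        | bot => exact absurd hx hbot
        | top =>
          rw [EReal.top_add_coe, EReal.coe_mul_top_of_pos hc', EReal.sub_top,
            EReal.coe_mul_bot_of_pos (by positivity)]
          simp
        | coe x =>
          rw [← EReal.coe_add, ← EReal.coe_mul, ← EReal.coe_sub, ← EReal.coe_mul, ← EReal.coe_sub,
            ← EReal.coe_mul, EReal.exp_coe, EReal.exp_coe, ← ENNReal.ofReal_mul (by norm_num),
            ← ENNReal.ofReal_add (by norm_num) (by positivity)]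
          refine ENNReal.ofReal_le_ofReal ?_
          -- `√t ≤ (1 + t) / 2`, as the exponent is halved
          have hhalf : η * n / (2 * (C / c)) * (ρ zs - C / c * (x + ε)) =
              (1 / 2) * (η * n * (ρ zs / (C / c) - 1 / n * ∑ _i : Fin n, ε - x)) := by
            simp only [Finset.sum_const, Finset.card_univ, Fintype.card_fin, nsmul_eq_mul]
            field_simp
            ring
          rw [hhalf]
          have := exp_mul_le_convex_comb (ρ := 1 / 2) (by norm_num) (by norm_num)
            (η * n * (ρ zs / (C / c) - 1 / n * ∑ _i : Fin n, ε - x))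
          linarith
    _ = ENNReal.ofReal (1 / 2) + ENNReal.ofReal (1 / 2) *
        ∫⁻ zs, EReal.exp (((η * n : ℝ) : EReal) *
        (((ρ zs / (C / c) - 1 / n * ∑ _i : Fin n, ε : ℝ) : EReal) -
          A.infoComplexity fstar n η zs)) ∂(Measure.pi fun _ : Fin n => L.P) := by
        rw [lintegral_add_left measurable_const, lintegral_const, measure_univ, mul_one,
          lintegral_const_mul' _ _ ENNReal.ofReal_ne_top]
    _ ≤ ENNReal.ofReal (1 / 2) + ENNReal.ofReal (1 / 2) * 1 := by gcongr
    _ = 1 := by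
        rw [mul_one, ← ENNReal.ofReal_add (by norm_num) (by norm_num)]
        norm_num

/-- Jensen's inequality for an extended-real difference: an exponential stochastic inequality
implies the corresponding inequality of expectations. -/
lemma integral_le_expect_of_lintegral_exp_le {Ω : Type*} [MeasurableSpace Ω] {μ : Measure Ω}
    [IsProbabilityMeasure μ] {Y : Ω → ℝ} (hY : Integrable Y μ) {X : Ω → EReal}
    (hX : Measurable X) (hbot : ∀ᵐ ω ∂μ, X ω ≠ ⊥) {a : ℝ} (ha : 0 < a)
    (h : ∫⁻ ω, EReal.exp ((a : EReal) * ((Y ω : EReal) - X ω)) ∂μ ≤ 1) :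
    ((∫ ω, Y ω ∂μ : ℝ) : EReal) ≤ expect μ X := by
  by_cases htop : expect μ X = ⊤
  · rw [htop]
    exact le_top
  -- `x ≥ y - (e^{a(y-x)} - 1)/a` provides the integrable lower bound
  set e : Ω → ENNReal := fun ω => EReal.exp ((a : EReal) * ((Y ω : EReal) - X ω)) with he
  have hem : AEMeasurable e μ := EReal.measurable_exp.comp_aemeasurable
    (((hY.aestronglyMeasurable.aemeasurable.coe_real_ereal).add hX.neg.aemeasurable).const_mul
      (a : EReal))
  have hei : Integrable (fun ω => (e ω).toReal) μ :=
    integrable_toReal_of_lintegral_ne_top hem (ne_top_of_le_ne_top ENNReal.one_ne_top h)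
  have heI : ∫ ω, (e ω).toReal ∂μ ≤ 1 := by
    rw [integral_toReal hem (ae_lt_top' hem (ne_top_of_le_ne_top ENNReal.one_ne_top h))]
    exact ENNReal.toReal_le_of_le_ofReal zero_le_one (by simpa using h)
  have hsub : Integrable (fun ω => ((e ω).toReal - 1) / a) μ :=
    (hei.sub (integrable_const 1)).div_const a
  have hle := integral_le_expect (U := X) (hY.sub hsub) (by
    filter_upwards [hbot] with ω hω
    induction hx : X ω with
    | bot => exact absurd hx hω
    | top => exact le_top
    | coe x =>
      have h1 : (e ω).toReal = Real.exp (a * (Y ω - x)) := by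
        simp only [he]
        rw [hx, ← EReal.coe_sub, ← EReal.coe_mul, EReal.exp_coe,
          ENNReal.toReal_ofReal (Real.exp_pos _).le]
      have h2 := Real.add_one_le_exp (a * (Y ω - x))
      have h3 : Y ω - x ≤ (Real.exp (a * (Y ω - x)) - 1) / a := by
        rw [le_div_iff₀ ha]
        linarith
      rw [Pi.sub_apply, h1, EReal.coe_le_coe_iff]
      linarith)
  refine le_trans ?_ hle
  rw [EReal.coe_le_coe_iff, integral_sub' hY hsub, integral_div,
    integral_sub hei (integrable_const 1)]
  have : (∫ ω, (e ω).toReal ∂μ - 1) / a ≤ 0 := div_nonpos_of_nonpos_of_nonneg (by linarith) ha.le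
  simp only [integral_const, probReal_univ, one_smul]
  linarith

/-- The inequality of expectations obtained from an arbitrary offset. -/
lemma LearningAlgorithm.expect_posteriorRisk_le (A : LearningAlgorithm L) {fstar : F}
    {κ ε η u c C : ℝ} {D : Z → ℝ} (hD : L.IsOffset fstar κ ε D) (hw : L.Witness fstar u c)
    (hη : 0 < η) (h : η < κ) (hu : 0 ≤ u) (hc : 0 < c) (hC0 : 0 < C)
    (hC : 1 + 2 * η * u ≤ C * (1 - η / κ)) {n : ℕ} (hn : 1 ≤ n) :
    expect (Measure.pi fun _ : Fin n => L.P) (A.posteriorRisk fstar n) ≤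
      ((C / c : ℝ) : EReal) *
        (expect (Measure.pi fun _ : Fin n => L.P) (A.infoComplexity fstar n η) + (ε : EReal)) := by
  have hn0 : (0 : ℝ) < n := by exact_mod_cast hn
  have hc' : 0 < C / c := by positivity
  obtain ⟨ρ, hρ, hρi, hexp⟩ := A.exists_posteriorRisk_eq hD hw hη h hu hc hC hn
  obtain ⟨hDi, hDE⟩ := integral_average hn hD.integrable
  have hbot : ∀ᵐ zs ∂(Measure.pi fun _ : Fin n => L.P), A.infoComplexity fstar n η zs ≠ ⊥ := by
    filter_upwards [LearningAlgorithm.ae_all_loss_ne_top hD.loss_ne_top n] with zs hzs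
    exact A.infoComplexity_ne_bot hη hzs
  have hle := integral_le_expect_of_lintegral_exp_le ((hρi.div_const (C / c)).sub hDi)
    (A.measurable_infoComplexity fstar n η) hbot (by positivity : 0 < η * n) hexp
  rw [integral_sub' (hρi.div_const (C / c)) hDi, hDE, integral_div] at hle
  rw [show A.posteriorRisk fstar n = fun zs => (ρ zs : EReal) from funext hρ, expect_coe hρi]
  have hadd := add_le_add hle (EReal.coe_le_coe_iff.2 hD.integral_le)
  rw [← EReal.coe_add, sub_add_cancel] at hadd
  have hmul := mul_le_mul_of_nonneg_left hadd (EReal.coe_nonneg.2 hc'.le)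
  rwa [← EReal.coe_mul, mul_div_cancel₀ _ hc'.ne'] at hmul

end Bounds
end ExcessRisk

theorem mainTheorem1 {Z F : Type*} [MeasurableSpace Z] [MeasurableSpace F]
    (L : ExcessRisk.LearningProblem Z F) (A : ExcessRisk.LearningAlgorithm L) (fstar : F)
    (u c : ℝ) (hu : 0 < u) (hc : 0 < c) (hc1 : c ≤ 1) (hwitness : L.Witness fstar u c)
    (v : NNReal → NNReal) (hv : ExcessRisk.IsEasinessFunction v) :
    (L.VCentral v →
      ∀ ε : NNReal, L.CentralUpTo fstar (v ε) ε →
      ∀ η : ℝ, 0 < η → η < v ε / 2 → ∀ n : ℕ, 1 ≤ n →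
        ExcessRisk.ESI (MeasureTheory.Measure.pi fun _ : Fin n => L.P)
          (η * n / (2 * ExcessRisk.cPrime u c η (v ε)))
          (A.posteriorRisk fstar n)
          (fun zs => (ExcessRisk.cPrime u c η (v ε) : EReal) *
            (A.infoComplexity fstar n η zs + ((ε : ℝ) : EReal)))) ∧
    (L.VPPC fstar v →
      ∀ ε : NNReal, ∀ η : ℝ, 0 < η → η < v ε / 2 → ∀ n : ℕ, 1 ≤ n →
        ExcessRisk.expect (MeasureTheory.Measure.pi fun _ : Fin n => L.P)
            (A.posteriorRisk fstar n) ≤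
          (ExcessRisk.cPrime u c η (v ε) : EReal) *
            (ExcessRisk.expect (MeasureTheory.Measure.pi fun _ : Fin n => L.P)
              (A.infoComplexity fstar n η) + ((ε : ℝ) : EReal))) := by
  have key : ∀ ε : NNReal, ∀ η : ℝ, 0 < η → η < v ε / 2 →
      η < v ε ∧ 0 < (2 * η * u + 1) / (1 - 2 * η / v ε) ∧
        1 + 2 * η * u ≤ (2 * η * u + 1) / (1 - 2 * η / v ε) * (1 - η / v ε) := by
    intro ε η hη hlt
    have hκ : (0 : ℝ) < v ε := by linarith
    have h1 : 0 < 1 - 2 * η / v ε := by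
      rw [sub_pos, div_lt_one hκ]
      linarith
    have h2 : η / v ε ≤ 2 * η / v ε := by
      gcongr
      linarith
    have h3 : 0 < 2 * η * u + 1 := by positivity
    refine ⟨by linarith, by positivity, ?_⟩
    rw [div_mul_eq_mul_div, le_div_iff₀ h1]
    nlinarith
  have hcp : ∀ η κ : ℝ, ExcessRisk.cPrime u c η κ = (2 * η * u + 1) / (1 - 2 * η / κ) / c := by
    intro η κ
    rw [ExcessRisk.cPrime]
    ring
  refine ⟨fun _ ε hcent η hη hlt n hn => ?_, fun hppc ε η hη hlt n hn => ?_⟩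
  · obtain ⟨h1, h2, h3⟩ := key ε η hη hlt
    rw [hcp]
    exact A.esi_posteriorRisk (hcent.isOffset (hη.trans h1) ε.2) hwitness hη h1 hu.le hc h2 h3 hn
  · obtain ⟨h1, h2, h3⟩ := key ε η hη hlt
    have hκ : (0 : ℝ) < v ε := hη.trans h1
    obtain ⟨D, hD⟩ := L.exists_isOffset_of_ppc hκ (hppc ε (by exact_mod_cast hκ))
    rw [hcp]
    exact A.expect_posteriorRisk_le hD hwitness hη h1 hu.le hc h2 h3 hn
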